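/- Let $(M,g)$ be a smooth four-dimensional spacetime with signature $(-,+,+,+)$, let $U\subseteq M$ be an open region, and let the entropy current $s^a$ be a vector field that is continuous on $U$. A light sheet $L$ is a smooth null hypersurface generated by affinely parametrized null geodesics with non-zero tangent $k^a$. They start orthogonally at a compact spacelike 2-surface $B$ (given in coordinates $x=(x^1,x^2)$, one-to-one up to measure zero, ranging over a compact set that lies in the closure of its interior). The generator through $x$ runs over $0\le\lambda\le\lambda_\infty(x)$, with $\lambda_\infty>0$ smooth, and ends on a 2-surface $B'$. All cross-sections of $L$ are spacelike (there is no caustic), and the expansion $\theta=\nabla_ak^a$ of $k^a$ along $L$ (that is, $\theta=h^{AB}g(\partial_A,\nabla_Bk)$, where $h_{AB}$ is the induced metric on the cross-sections $\lambda=\mathrm{const}$) is non-positive everywhere on $L$. Put $s=-k^as_a$ and let $$S_L=\int_B d^2x\int_0^{\lambda_\infty(x)}d\lambda\; s\,\sqrt{\det h_{AB}(x,\lambda)}$$ be the entropy through $L$. Let $A_B$ and $A_{B'}$ be the areas of $B$ and $B'$ in the metrics induced by $g$. The generalized covariant entropy bound for $L$ is $$S_L\le\tfrac14\,(A_B-A_{B'}),$$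 and condition (A) is the pointwise inequality $s\le-\tfrac14\theta$. Then: 1. Let $\mathcal N$ be any set of tangent vectors of $M$ (the set of all tangent vectors gives all light sheets). The bound holds for every light sheet contained in $U$ whose tangents $k^a$ belong to $\mathcal N$ if and only if condition (A) holds at every point $p\in U$, for every light sheet through $p$ whose tangents belong to $\mathcal N$. 2. Let $K^a$ be a vector field that is $C^1$ on $U$, such that every point of $U$ lies on a light sheet in $U$ generated by $K^a$ (that is, with $k^a=K^a$ on it). The bound holds for every light sheet in $U$ generated by $K^a$ if and only if $-K^as_a\le-\tfrac14\nabla_aK^a$ at every point of $U$. -/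

import Mathlib

open scoped Manifold ContDiff Topology

namespace EntropyBound

/-- The model space of a spacetime. -/
abbrev E4 : Type := EuclideanSpace ℝ (Fin 4)

/-- The parameter space of a light sheet: coordinates `(x¹, x²)` on the initial surface together
with the parameter `lam` along the generators. -/
abbrev Param : Type := (Fin 2 → ℝ) × ℝ

section

variable {M : Type*} [TopologicalSpace M] [ChartedSpace E4 M] [IsManifold (𝓡 4) ∞ M]

variable (M) in
/-- A smooth Lorentzian metric, of signature `(-,+,+,+)`, on a smooth `4`-manifold. -/
structure LorentzMetric where
  /-- the inner product of two tangent vectors at `p` -/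
  val : ∀ p : M, TangentSpace (𝓡 4) p →L[ℝ] (TangentSpace (𝓡 4) p →L[ℝ] ℝ)
  symm : ∀ (p : M) (v w : TangentSpace (𝓡 4) p), val p v w = val p w v
  signature : ∀ p : M, ∃ b : Module.Basis (Fin 4) ℝ (TangentSpace (𝓡 4) p),
    ∀ i j, val p (b i) (b j) = if i = j then (if i = 0 then -1 else 1) else 0
  contMDiff : ContMDiff (𝓡 4) ((𝓡 4).prod 𝓘(ℝ, E4 →L[ℝ] E4 →L[ℝ] ℝ)) ∞
    (fun p ↦ Bundle.TotalSpace.mk' (E4 →L[ℝ] E4 →L[ℝ] ℝ) p (val p))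

namespace LorentzMetric

variable (g : LorentzMetric M)

/-- The components `g_{ij}`, at the coordinate point `y`, of the metric in the chart around `q`. -/
noncomputable def coeff (q : M) (y : E4) : Matrix (Fin 4) (Fin 4) ℝ :=
  Matrix.of fun i j ↦
    g.val ((extChartAt (𝓡 4) q).symm y)
      (mfderiv 𝓘(ℝ, E4) (𝓡 4) (extChartAt (𝓡 4) q).symm y (EuclideanSpace.single i (1 : ℝ)))
      (mfderiv 𝓘(ℝ, E4) (𝓡 4) (extChartAt (𝓡 4) q).symm y (EuclideanSpace.single j (1 : ℝ)))

/-- The partial derivative `∂_l g_{ij}` in the chart around `q`. -/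
noncomputable def dcoeff (q : M) (y : E4) (l i j : Fin 4) : ℝ :=
  fderiv ℝ (fun y' ↦ g.coeff q y' i j) y (EuclideanSpace.single l (1 : ℝ))

/-- The Christoffel symbols `Γ^i_{jl} = ½ g^{im} (∂_j g_{ml} + ∂_l g_{mj} - ∂_m g_{jl})` of the
Levi-Civita connection in the chart around `q`. -/
noncomputable def christoffel (q : M) (y : E4) (i j l : Fin 4) : ℝ :=
  (1 / 2) * ∑ m, (g.coeff q y)⁻¹ i m *
    (g.dcoeff q y j m l + g.dcoeff q y l m j - g.dcoeff q y m j l)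

/-- The covariant derivative `D_v (∂_w Φ)` at the parameter point `z`, along a map `Φ` into the
spacetime, of the vector field `∂_w Φ` in the parameter direction `v`. It is computed in the
preferred chart around `Φ z`, in which a tangent vector at `Φ z` is its column of components. -/
noncomputable def covDerivAlong (Φ : Param → M) (z v w : Param) : TangentSpace (𝓡 4) (Φ z) :=
  let ψ : Param → E4 := fun z' ↦ extChartAt (𝓡 4) (Φ z) (Φ z')
  (WithLp.toLp 2 fun i ↦
    fderiv ℝ (fun z' ↦ fderiv ℝ ψ z' w i) z v +
      ∑ j, ∑ l, g.christoffel (Φ z) (ψ z) i j l * fderiv ℝ ψ z v j * fderiv ℝ ψ z w l : E4)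

/-- The divergence `∇_a K^a = ∂_i K^i + Γ^i_{ij} K^j` of a vector field at the point `q`, computed
in the preferred chart around `q`. -/
noncomputable def divergence (K : ∀ p : M, TangentSpace (𝓡 4) p) (q : M) : ℝ :=
  let φ := extChartAt (𝓡 4) q
  let Kc : E4 → E4 := fun y ↦ mfderiv (𝓡 4) 𝓘(ℝ, E4) φ (φ.symm y) (K (φ.symm y))
  ∑ i, fderiv ℝ (fun y ↦ Kc y i) (φ q) (EuclideanSpace.single i (1 : ℝ)) +
    ∑ i, ∑ j, g.christoffel q (φ q) i i j * Kc (φ q) j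

/-- The induced metric `g(∂_A β, ∂_B β)` of a parametrized surface. -/
noncomputable def inducedMetric (β : (Fin 2 → ℝ) → M) (x : Fin 2 → ℝ) :
    Matrix (Fin 2) (Fin 2) ℝ :=
  Matrix.of fun A B ↦
    g.val (β x)
      (mfderiv 𝓘(ℝ, Fin 2 → ℝ) (𝓡 4) β x (Pi.single A (1 : ℝ)))
      (mfderiv 𝓘(ℝ, Fin 2 → ℝ) (𝓡 4) β x (Pi.single B (1 : ℝ)))

/-- The area of the parametrized surface `β : D → M`. -/
noncomputable def area (β : (Fin 2 → ℝ) → M) (D : Set (Fin 2 → ℝ)) : ℝ :=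
  ∫ x in D, Real.sqrt (g.inducedMetric β x).det

end LorentzMetric

/-- The parameter direction of the coordinate `x^A`. -/
def dirX (A : Fin 2) : Param := (Pi.single A 1, 0)

/-- The parameter direction of the generators. -/
def dirL : Param := (0, 1)

/-- The coordinate vector `∂_A Φ`. -/
noncomputable def tangentX (Φ : Param → M) (A : Fin 2) (z : Param) : TangentSpace (𝓡 4) (Φ z) :=
  mfderiv 𝓘(ℝ, Param) (𝓡 4) Φ z (dirX A)

/-- The tangent `k = ∂Φ/∂lam` of the generators. -/
noncomputable def generator (Φ : Param → M) (z : Param) : TangentSpace (𝓡 4) (Φ z) :=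
  mfderiv 𝓘(ℝ, Param) (𝓡 4) Φ z dirL

/-- The metric `h_{AB} = g(∂_A Φ, ∂_B Φ)` induced on the cross-section `lam = const`. -/
noncomputable def sectionMetric (g : LorentzMetric M) (Φ : Param → M) (z : Param) :
    Matrix (Fin 2) (Fin 2) ℝ :=
  Matrix.of fun A B ↦ g.val (Φ z) (tangentX Φ A z) (tangentX Φ B z)

/-- The expansion of `k` on a null hypersurface: the divergence `∇_a k^a`, that is the trace
`h^{AB} g(D_A k, ∂_B Φ)`, with the covariant derivative taken along the hypersurface, where
`k` lives. -/
noncomputable def expansion (g : LorentzMetric M) (Φ : Param → M) (z : Param) : ℝ :=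
  ∑ A, ∑ B, (sectionMetric g Φ z)⁻¹ A B *
    g.val (Φ z) (g.covDerivAlong Φ z (dirX A) dirL) (tangentX Φ B z)

/-- A light sheet: a null hypersurface generated by null geodesics that start orthogonally at a
compact spacelike surface `B`, have non-positive expansion, and are terminated at a spacelike
surface `B'` before a caustic is reached. The coordinates `x` range over `D`, the affine
parameter of the generator through `x` over `[0, endpoint x]`; `B` is `lam = 0`, and `B'` is
`lam = endpoint x`. (A compact surface that needs several coordinate patches is presented by a set
`D` with several components; the coordinates are one-to-one up to a set of measure zero.) -/
structure LightSheet (g : LorentzMetric M) where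
  /-- the coordinate domain of `B` -/
  D : Set (Fin 2 → ℝ)
  isCompact : IsCompact D
  subset_closure_interior : D ⊆ closure (interior D)
  /-- the affine parameter at which a generator reaches `B'` -/
  endpoint : (Fin 2 → ℝ) → ℝ
  endpoint_pos : ∀ x ∈ D, 0 < endpoint x
  endpoint_smooth : ∃ V : Set (Fin 2 → ℝ), IsOpen V ∧ D ⊆ V ∧ ContDiffOn ℝ ∞ endpoint V
  /-- the parametrization -/
  Φ : Param → M
  smooth : ∃ W : Set Param, IsOpen W ∧ {z : Param | z.1 ∈ D ∧ 0 ≤ z.2 ∧ z.2 ≤ endpoint z.1} ⊆ W ∧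
    ContMDiffOn 𝓘(ℝ, Param) (𝓡 4) ∞ Φ W
  injective : ∃ N : Set (Fin 2 → ℝ), MeasureTheory.volume N = 0 ∧
    Set.InjOn (fun x ↦ Φ (x, 0)) (D \ N)
  /-- The cross-sections are spacelike surfaces; in particular `B` and `B'` are, and there is no
  caustic. -/
  spacelike : ∀ z : Param, z.1 ∈ D → 0 ≤ z.2 → z.2 ≤ endpoint z.1 → (sectionMetric g Φ z).PosDef
  ne_zero : ∀ z : Param, z.1 ∈ D → 0 ≤ z.2 → z.2 ≤ endpoint z.1 → generator Φ z ≠ 0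
  null : ∀ z : Param, z.1 ∈ D → 0 ≤ z.2 → z.2 ≤ endpoint z.1 →
    g.val (Φ z) (generator Φ z) (generator Φ z) = 0
  /-- The hypersurface is null, with normal `k`; in particular `k` is orthogonal to `B`. -/
  normal : ∀ z : Param, z.1 ∈ D → 0 ≤ z.2 → z.2 ≤ endpoint z.1 → ∀ A,
    g.val (Φ z) (generator Φ z) (tangentX Φ A z) = 0
  /-- The generators are affinely parametrized geodesics. -/
  geodesic : ∀ z : Param, z.1 ∈ D → 0 ≤ z.2 → z.2 ≤ endpoint z.1 →
    g.covDerivAlong Φ z dirL dirL = 0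
  expansion_nonpos : ∀ z : Param, z.1 ∈ D → 0 ≤ z.2 → z.2 ≤ endpoint z.1 → expansion g Φ z ≤ 0

namespace LightSheet

variable {g : LorentzMetric M} (L : LightSheet g)

/-- The set of parameters of the light sheet. -/
def params : Set Param := {z : Param | z.1 ∈ L.D ∧ 0 ≤ z.2 ∧ z.2 ≤ L.endpoint z.1}

/-- The set of points of the light sheet. -/
def carrier : Set M := L.Φ '' L.params

/-- All tangents `k` of the generators belong to the set `N` of tangent vectors. -/
def TangentIn (N : Set (TangentBundle (𝓡 4) M)) : Prop :=
  ∀ z ∈ L.params, (⟨L.Φ z, generator L.Φ z⟩ : TangentBundle (𝓡 4) M) ∈ N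

/-- The light sheet is generated by the vector field `K`. -/
def GeneratedBy (K : ∀ p : M, TangentSpace (𝓡 4) p) : Prop :=
  ∀ z ∈ L.params, generator L.Φ z = K (L.Φ z)

/-- The area of the initial surface `B`. -/
noncomputable def areaB : ℝ := g.area (fun x ↦ L.Φ (x, 0)) L.D

/-- The area of the final surface `B'`. -/
noncomputable def areaB' : ℝ := g.area (fun x ↦ L.Φ (x, L.endpoint x)) L.D

/-- The entropy flux `s = - k^a s_a` across the light sheet. -/
noncomputable def flux (S : ∀ p : M, TangentSpace (𝓡 4) p) (z : Param) : ℝ :=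
  - g.val (L.Φ z) (generator L.Φ z) (S (L.Φ z))

/-- The entropy `S_L` through the light sheet: the integral of the flux `s` over the null
hypersurface, whose surface element is `d lam` times the area element of the cross-sections. -/
noncomputable def entropy (S : ∀ p : M, TangentSpace (𝓡 4) p) : ℝ :=
  ∫ x in L.D, ∫ lam in (0 : ℝ)..(L.endpoint x),
    L.flux S (x, lam) * Real.sqrt (sectionMetric g L.Φ (x, lam)).det

/-- The generalized covariant entropy bound for the light sheet. -/
def EntropyBoundHolds (S : ∀ p : M, TangentSpace (𝓡 4) p) : Prop :=
  L.entropy S ≤ (1 / 4) * (L.areaB - L.areaB')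

end LightSheet

/-- The pointwise condition `s ≤ -θ/4` at the spacetime point `p`, for the light sheets through `p`
whose tangents belong to `N`. -/
def ConditionA (g : LorentzMetric M) (S : ∀ p : M, TangentSpace (𝓡 4) p)
    (N : Set (TangentBundle (𝓡 4) M)) (p : M) : Prop :=
  ∀ L : LightSheet g, L.TangentIn N → ∀ z ∈ L.params, L.Φ z = p →
    L.flux S z ≤ -(1 / 4) * expansion g L.Φ z

end

end EntropyBound

/-! Along a generator the area element `√det h` satisfies `∂_λ √det h = θ √det h`. Integrating over
a light sheet gives `A_{B'} - A_B = ∫∫ θ √det h`, so `S_L - (A_B - A_{B'})/4` is the integral of `(s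
+ θ/4) √det h` (`LightSheet.entropy_sub_eq`). Hence condition (A) implies the bound.

Conversely, suppose `s + θ/4 > 0` at one point of a sheet. By continuity this holds nearby, and a
small piece of the sheet (a ball of generators, a short interval of `λ`) is again a light sheet with
the same tangents. It lies in `U`, its surplus is positive everywhere, and so it violates the bound
(`LightSheet.exists_not_entropyBoundHolds`). The freedom to shrink the sheet turns an integral
inequality into a pointwise one.

For a field `K`, take `N` to be the set of values of `K` and replace `θ` by `∇_a K^a`
(`LightSheet.expansion_eq_divergence`). The map `v ↦ ∇_v K` kills `K` because the generators are
affine geodesics, and its image is orthogonal to `K` because `K` is null on all of `U`. In a basis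
`K, ∂_1, ∂_2, l` its trace therefore reduces to the trace over the cross-section, which is `θ`.

The differential geometry underneath is proved in charts: the connection given by the Christoffel
symbols is metric (`LorentzMetric.fderiv_val`) and torsion-free
(`LorentzMetric.covDerivAlong_symm`). -/

namespace EntropyBound
section
variable {M : Type*} [TopologicalSpace M] [ChartedSpace E4 M] [IsManifold (𝓡 4) ∞ M]

/-! ### Metric compatibility of the Christoffel symbols, in components. -/

namespace LorentzMetric
variable (g : LorentzMetric M)

lemma coeff_symm (q : M) (y : E4) (i j : Fin 4) : g.coeff q y i j = g.coeff q y j i :=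
  g.symm _ _ _

lemma dcoeff_symm (q : M) (y : E4) (l i j : Fin 4) : g.dcoeff q y l i j = g.dcoeff q y l j i := by
  simp only [dcoeff, g.coeff_symm q _ i j]

/-- Lowering the upper index of the Christoffel symbols. -/
lemma sum_coeff_mul_christoffel {q : M} {y : E4} (hdet : IsUnit (g.coeff q y).det)
    (n j l : Fin 4) :
    ∑ i, g.coeff q y n i * g.christoffel q y i j l =
      (1 / 2) * (g.dcoeff q y j n l + g.dcoeff q y l n j - g.dcoeff q y n j l) := by
  set v : Fin 4 → ℝ := fun m ↦ g.dcoeff q y j m l + g.dcoeff q y l m j - g.dcoeff q y m j l with hv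
  have h1 : ∀ i, g.christoffel q y i j l = (1 / 2) * ((g.coeff q y)⁻¹.mulVec v) i := fun i ↦ rfl
  have h2 : (g.coeff q y).mulVec ((g.coeff q y)⁻¹.mulVec v) = v := by
    rw [Matrix.mulVec_mulVec, Matrix.mul_nonsing_inv _ hdet, Matrix.one_mulVec]
  calc ∑ i, g.coeff q y n i * g.christoffel q y i j l
      = (1 / 2) * ((g.coeff q y).mulVec ((g.coeff q y)⁻¹.mulVec v)) n := by
        simp only [h1, Matrix.mulVec, dotProduct, Finset.mul_sum]
        refine Finset.sum_congr rfl fun i _ ↦ Finset.sum_congr rfl fun m _ ↦ by ring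
    _ = _ := by rw [h2]

/-- The Christoffel symbols contracted with two vectors. -/
noncomputable def connection (q : M) (y u a : E4) (i : Fin 4) : ℝ :=
  ∑ j, ∑ l, g.christoffel q y i j l * u j * a l

/-- The algebraic form of the compatibility of the Levi-Civita connection with the metric. -/
lemma connection_compatible {q : M} {y : E4} (hdet : IsUnit (g.coeff q y).det) (u a b : E4) :
    ∑ i, ∑ j, g.coeff q y i j * g.connection q y u a i * b j +
      ∑ i, ∑ j, g.coeff q y i j * a i * g.connection q y u b j =
    ∑ i, ∑ j, (∑ l, u l * g.dcoeff q y l i j) * a i * b j := by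
  -- Lowering the index leaves Christoffel symbols of the first kind, free of the inverse metric.
  have key : ∀ a b : E4, ∑ i, ∑ j, g.coeff q y i j * g.connection q y u a i * b j =
      ∑ n, ∑ p, ∑ l, (1 / 2) * (g.dcoeff q y p n l + g.dcoeff q y l n p - g.dcoeff q y n p l) *
        (u p * a l * b n) := by
    intro a b
    rw [Finset.sum_comm]
    refine Finset.sum_congr rfl fun n _ ↦ ?_
    simp only [← g.sum_coeff_mul_christoffel hdet, connection, Finset.mul_sum, Finset.sum_mul]
    rw [Finset.sum_comm]
    refine Finset.sum_congr rfl fun p _ ↦ ?_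
    rw [Finset.sum_comm]
    refine Finset.sum_congr rfl fun l _ ↦ Finset.sum_congr rfl fun i _ ↦ ?_
    rw [g.coeff_symm q y i n]; ring
  have key2 : ∑ i, ∑ j, g.coeff q y i j * a i * g.connection q y u b j =
      ∑ i, ∑ j, g.coeff q y i j * g.connection q y u b i * a j := by
    rw [Finset.sum_comm]
    refine Finset.sum_congr rfl fun i _ ↦ Finset.sum_congr rfl fun j _ ↦ ?_
    rw [g.coeff_symm q y j i]; ring
  rw [key2, key, key]
  -- Exchanging the names `n` and `l` aligns the two sums: the terms antisymmetric in them cancel,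
  -- and `∂_p g_{nl}` is left.
  have e1 : ∑ n, ∑ p, ∑ l, (1 / 2) * (g.dcoeff q y p n l + g.dcoeff q y l n p -
      g.dcoeff q y n p l) * (u p * b l * a n) =
      ∑ n, ∑ p, ∑ l, (1 / 2) * (g.dcoeff q y p l n + g.dcoeff q y n l p -
      g.dcoeff q y l p n) * (u p * b n * a l) := by
    calc _ = ∑ p, ∑ n, ∑ l, (1 / 2) * (g.dcoeff q y p n l + g.dcoeff q y l n p -
      g.dcoeff q y n p l) * (u p * b l * a n) := Finset.sum_comm
      _ = ∑ p, ∑ l, ∑ n, (1 / 2) * (g.dcoeff q y p n l + g.dcoeff q y l n p -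
      g.dcoeff q y n p l) * (u p * b l * a n) :=
          Finset.sum_congr rfl fun p _ ↦ Finset.sum_comm
      _ = _ := Finset.sum_comm
  rw [e1, ← Finset.sum_add_distrib, Finset.sum_comm (s := Finset.univ (α := Fin 4))
    (f := fun i j ↦ (∑ l, u l * g.dcoeff q y l i j) * a i * b j)]
  refine Finset.sum_congr rfl fun n _ ↦ ?_
  simp only [← Finset.sum_add_distrib, Finset.sum_mul]
  rw [Finset.sum_comm]
  refine Finset.sum_congr rfl fun l _ ↦ Finset.sum_congr rfl fun p _ ↦ ?_
  rw [g.dcoeff_symm q y l n p, g.dcoeff_symm q y n l p, g.dcoeff_symm q y p n l]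
  ring

/-- The derivative of the inner product of two vector fields along a map into the chart around
`q`. -/
lemma fderiv_sum_coeff {F : Type*} [NormedAddCommGroup F] [NormedSpace ℝ F] {q : M}
    {ψ a b : F → E4} {z : F} (hdet : IsUnit (g.coeff q (ψ z)).det)
    (hG : ∀ i j, DifferentiableAt ℝ (fun y ↦ g.coeff q y i j) (ψ z))
    (hψ : DifferentiableAt ℝ ψ z) (ha : ∀ i, DifferentiableAt ℝ (fun z' ↦ a z' i) z)
    (hb : ∀ i, DifferentiableAt ℝ (fun z' ↦ b z' i) z) (u : F) :
    fderiv ℝ (fun z' ↦ ∑ i, ∑ j, g.coeff q (ψ z') i j * a z' i * b z' j) z u =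
      ∑ i, ∑ j, g.coeff q (ψ z) i j *
        (fderiv ℝ (fun z' ↦ a z' i) z u + g.connection q (ψ z) (fderiv ℝ ψ z u) (a z) i) * b z j +
      ∑ i, ∑ j, g.coeff q (ψ z) i j * a z i *
        (fderiv ℝ (fun z' ↦ b z' j) z u + g.connection q (ψ z) (fderiv ℝ ψ z u) (b z) j) := by
  have hGu : ∀ i j, fderiv ℝ (fun y ↦ g.coeff q y i j) (ψ z) (fderiv ℝ ψ z u) =
      ∑ l, fderiv ℝ ψ z u l * g.dcoeff q (ψ z) l i j := by
    intro i j
    conv_lhs => rw [← (EuclideanSpace.basisFun (Fin 4) ℝ).sum_repr (fderiv ℝ ψ z u)]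
    rw [map_sum]
    refine Finset.sum_congr rfl fun l _ ↦ ?_
    rw [map_smul, smul_eq_mul, EuclideanSpace.basisFun_repr, EuclideanSpace.basisFun_apply]
    rfl
  have h1 : HasFDerivAt (fun z' ↦ ∑ i, ∑ j, g.coeff q (ψ z') i j * a z' i * b z' j)
      (∑ i, ∑ j, ((g.coeff q (ψ z) i j * a z i) • fderiv ℝ (fun z' ↦ b z' j) z +
        b z j • (g.coeff q (ψ z) i j • fderiv ℝ (fun z' ↦ a z' i) z +
          a z i • (fderiv ℝ (fun y ↦ g.coeff q y i j) (ψ z)).comp (fderiv ℝ ψ z)))) z :=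
    HasFDerivAt.fun_sum fun i _ ↦ HasFDerivAt.fun_sum fun j _ ↦
      (((hG i j).hasFDerivAt.comp z hψ.hasFDerivAt).mul (ha i).hasFDerivAt).mul
        (hb j).hasFDerivAt
  rw [h1.fderiv]
  -- The product-rule term in which the metric is differentiated is exactly the sum of the two
  -- connection terms.
  have h2 := g.connection_compatible hdet (fderiv ℝ ψ z u) (a z) (b z)
  have h3 : ∀ i j, g.coeff q (ψ z) i j *
        (fderiv ℝ (fun z' ↦ a z' i) z u + g.connection q (ψ z) (fderiv ℝ ψ z u) (a z) i) * b z j =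
      g.coeff q (ψ z) i j * fderiv ℝ (fun z' ↦ a z' i) z u * b z j +
      g.coeff q (ψ z) i j * g.connection q (ψ z) (fderiv ℝ ψ z u) (a z) i * b z j := by
    intros; ring
  have h4 : ∀ i j, g.coeff q (ψ z) i j * a z i *
        (fderiv ℝ (fun z' ↦ b z' j) z u + g.connection q (ψ z) (fderiv ℝ ψ z u) (b z) j) =
      g.coeff q (ψ z) i j * a z i * fderiv ℝ (fun z' ↦ b z' j) z u +
      g.coeff q (ψ z) i j * a z i * g.connection q (ψ z) (fderiv ℝ ψ z u) (b z) j := by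
    intros; ring
  simp only [h3, h4, Finset.sum_add_distrib]
  rw [add_add_add_comm, h2]
  simp only [sum_apply, ← Finset.sum_add_distrib]
  refine Finset.sum_congr rfl fun i _ ↦ Finset.sum_congr rfl fun j _ ↦ ?_
  rw [← hGu]
  simp only [add_apply, smul_apply, smul_eq_mul,
    ContinuousLinearMap.comp_apply]
  ring

end LorentzMetric
end
end EntropyBound

/-! ### Tangent vectors and the metric in chart components; nondegeneracy. -/

namespace EntropyBound
section
variable {M : Type*} [TopologicalSpace M] [ChartedSpace E4 M] [IsManifold (𝓡 4) ∞ M]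

lemma mfderiv_extChartAt_symm_comp (q p : M) (hp : p ∈ (extChartAt (𝓡 4) q).source)
    (v : TangentSpace (𝓡 4) p) :
    mfderiv 𝓘(ℝ, E4) (𝓡 4) (extChartAt (𝓡 4) q).symm (extChartAt (𝓡 4) q p)
      (mfderiv (𝓡 4) 𝓘(ℝ, E4) (extChartAt (𝓡 4) q) p v) = v := by
  have : IsManifold (𝓡 4) 1 M := .of_le (n := ∞) (by simp)
  have h := mfderivWithin_extChartAt_symm_comp_mfderiv_extChartAt' (I := 𝓡 4) hp
  rw [ModelWithCorners.range_eq_univ, mfderivWithin_univ] at h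
  exact DFunLike.congr_fun h v

lemma mfderiv_extChartAt_self_apply (q : M) (v : TangentSpace (𝓡 4) q) :
    mfderiv (𝓡 4) 𝓘(ℝ, E4) (extChartAt (𝓡 4) q) q v = v := by
  have : IsManifold (𝓡 4) 1 M := .of_le (n := ∞) (by simp)
  rw [mfderiv_extChartAt_self]; rfl

/-- The components, in the chart around `q`, of a tangent vector at `p`. -/
noncomputable def chartVec (q p : M) : TangentSpace (𝓡 4) p →L[ℝ] E4 :=
  mfderiv (𝓡 4) 𝓘(ℝ, E4) (extChartAt (𝓡 4) q) p

/-- The components of a tangent vector in the preferred chart around its base point. -/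
noncomputable def comp (p : M) : TangentSpace (𝓡 4) p ≃L[ℝ] E4 :=
  ContinuousLinearEquiv.refl ℝ E4

lemma chartVec_self (q : M) (v : TangentSpace (𝓡 4) q) : chartVec q q v = comp q v :=
  mfderiv_extChartAt_self_apply q v

/-- The bundled derivative of a smooth map in a constant direction is smooth. -/
lemma contMDiffOn_mfderiv_apply {F : Type*} [NormedAddCommGroup F] [NormedSpace ℝ F]
    {Φ : F → M} {W : Set F} (hW : IsOpen W) (hΦ : ContMDiffOn 𝓘(ℝ, F) (𝓡 4) ∞ Φ W) (v : F) :
    ContMDiffOn 𝓘(ℝ, F) (𝓡 4).tangent ∞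
      (fun z ↦ (⟨Φ z, mfderiv 𝓘(ℝ, F) (𝓡 4) Φ z v⟩ : TangentBundle (𝓡 4) M)) W := by
  have : IsManifold (𝓡 4) 1 M := .of_le (n := ∞) (by simp)
  have h1 : ContMDiffOn 𝓘(ℝ, F).tangent (𝓡 4).tangent ∞
      (tangentMapWithin 𝓘(ℝ, F) (𝓡 4) Φ W) (Bundle.TotalSpace.proj ⁻¹' W) :=
    hΦ.contMDiffOn_tangentMapWithin (by simp) hW.uniqueMDiffOn
  have h2 : ContMDiffOn 𝓘(ℝ, F) 𝓘(ℝ, F).tangent ∞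
      (fun z ↦ (⟨z, v⟩ : TangentBundle 𝓘(ℝ, F) F)) W :=
    contMDiffOn_vectorSpace_iff_contDiffOn.2 contDiffOn_const
  refine (h1.comp h2 fun z hz ↦ hz).congr fun z hz ↦ ?_
  simp only [Function.comp_apply, tangentMapWithin, mfderivWithin_of_isOpen hW hz]

namespace LorentzMetric
variable (g : LorentzMetric M)

/-- The inner product of two smooth vector fields along a smooth map is smooth. -/
lemma contDiffWithinAt_val {F : Type*} [NormedAddCommGroup F] [NormedSpace ℝ F] {n : ℕ∞}
    {Φ : F → M} {W : Set F} {z : F} {v w : ∀ z, TangentSpace (𝓡 4) (Φ z)}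
    (hv : ContMDiffWithinAt 𝓘(ℝ, F) (𝓡 4).tangent n
      (fun z ↦ (⟨Φ z, v z⟩ : TangentBundle (𝓡 4) M)) W z)
    (hw : ContMDiffWithinAt 𝓘(ℝ, F) (𝓡 4).tangent n
      (fun z ↦ (⟨Φ z, w z⟩ : TangentBundle (𝓡 4) M)) W z) :
    ContDiffWithinAt ℝ n (fun z ↦ g.val (Φ z) (v z) (w z)) W z := by
  have : IsManifold (𝓡 4) 1 M := .of_le (n := ∞) (by simp)
  have : IsManifold (𝓡 4) (n + 1) M := .of_le (n := ∞) (by exact_mod_cast le_top)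
  have hΦ : ContMDiffWithinAt 𝓘(ℝ, F) (𝓡 4) n Φ W z :=
    (Bundle.contMDiffWithinAt_totalSpace.1 hv).1
  have hg : ContMDiffWithinAt 𝓘(ℝ, F) ((𝓡 4).prod 𝓘(ℝ, E4 →L[ℝ] E4 →L[ℝ] ℝ)) n
      (fun z ↦ Bundle.TotalSpace.mk' (E4 →L[ℝ] E4 →L[ℝ] ℝ)
        (E := fun p : M ↦ TangentSpace (𝓡 4) p →L[ℝ] TangentSpace (𝓡 4) p →L[ℝ] ℝ)
        (Φ z) (g.val (Φ z))) W z :=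
    (g.contMDiff.contMDiffAt.of_le (by exact_mod_cast le_top)).comp_contMDiffWithinAt z hΦ
  have h := ContMDiffWithinAt.clm_bundle_apply₂ (E₃ := Bundle.Trivial M ℝ) (F₃ := ℝ) hg hv hw
  rw [Bundle.contMDiffWithinAt_totalSpace] at h
  exact h.2.contDiffWithinAt

lemma contDiffOn_coeff (q : M) (i j : Fin 4) :
    ContDiffOn ℝ ∞ (fun y ↦ g.coeff q y i j) (extChartAt (𝓡 4) q).target := by
  intro y hy
  have h := contMDiffOn_mfderiv_apply (isOpen_extChartAt_target (I := 𝓡 4) q)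
    (contMDiffOn_extChartAt_symm (n := ∞) q)
  exact g.contDiffWithinAt_val (n := ⊤) (h (EuclideanSpace.single i 1) y hy)
    (h (EuclideanSpace.single j 1) y hy)

lemma differentiableAt_coeff (q : M) (i j : Fin 4) {y : E4}
    (hy : y ∈ (extChartAt (𝓡 4) q).target) : DifferentiableAt ℝ (fun y ↦ g.coeff q y i j) y :=
  ((g.contDiffOn_coeff q i j).contDiffAt
    ((isOpen_extChartAt_target q).mem_nhds hy)).differentiableAt (by simp)

/-- The inner product in terms of components. -/
lemma val_eq_sum_coeff {q p : M} (hp : p ∈ (extChartAt (𝓡 4) q).source)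
    (v w : TangentSpace (𝓡 4) p) :
    g.val p v w = ∑ i, ∑ j, g.coeff q (extChartAt (𝓡 4) q p) i j *
      chartVec q p v i * chartVec q p w j := by
  set y := extChartAt (𝓡 4) q p with hy
  have hpy : (extChartAt (𝓡 4) q).symm y = p := (extChartAt (𝓡 4) q).left_inv hp
  -- The derivatives of the chart and of its inverse are mutually inverse, so a vector is recovered
  -- from its components in the coordinate basis.
  have hexp : ∀ v : TangentSpace (𝓡 4) p, v = ∑ i, chartVec q p v i •
      (mfderiv 𝓘(ℝ, E4) (𝓡 4) (extChartAt (𝓡 4) q).symm y (EuclideanSpace.single i (1 : ℝ)) :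
        E4) := by
    intro v
    have h1 := mfderiv_extChartAt_symm_comp q p hp v
    have h2 := (EuclideanSpace.basisFun (Fin 4) ℝ).sum_repr (chartVec q p v)
    simp only [EuclideanSpace.basisFun_repr, EuclideanSpace.basisFun_apply] at h2
    let T : E4 →L[ℝ] E4 := mfderiv 𝓘(ℝ, E4) (𝓡 4) (extChartAt (𝓡 4) q).symm y
    have h3 : T (chartVec q p v) = v := h1
    rw [← h2, map_sum] at h3
    refine h3.symm.trans (Finset.sum_congr rfl fun i _ ↦ ?_)
    rw [map_smul]; rfl
  let G : E4 →L[ℝ] E4 →L[ℝ] ℝ := g.val p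
  let e : Fin 4 → E4 := fun i ↦
    mfderiv 𝓘(ℝ, E4) (𝓡 4) (extChartAt (𝓡 4) q).symm y (EuclideanSpace.single i (1 : ℝ))
  have hG : ∀ i j, g.coeff q y i j = G (e i) (e j) := by
    intro i j
    change g.val ((extChartAt (𝓡 4) q).symm y) (e i) (e j) = _
    rw [hpy]; rfl
  have : G v w = ∑ i, ∑ j, G (e i) (e j) * chartVec q p v i * chartVec q p w j := by
    have hv : (v : E4) = ∑ i, chartVec q p v i • e i := hexp v
    have hw : (w : E4) = ∑ i, chartVec q p w i • e i := hexp w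
    conv_lhs => rw [hv, hw]
    simp only [map_sum, sum_apply, map_smul, smul_apply, smul_eq_mul, Finset.mul_sum]
    rw [Finset.sum_comm]
    exact Finset.sum_congr rfl fun i _ ↦ Finset.sum_congr rfl fun j _ ↦ by ring
  simp only [hG]
  exact this

lemma val_eq_sum_coeff_self (q : M) (v w : TangentSpace (𝓡 4) q) :
    g.val q v w = ∑ i, ∑ j, g.coeff q (extChartAt (𝓡 4) q q) i j * comp q v i * comp q w j := by
  simp only [g.val_eq_sum_coeff (mem_extChartAt_source (I := 𝓡 4) q), chartVec_self]

/-- Pairing with the orthonormal basis given by the signature reads off each component up to sign.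
-/
lemma nondegenerate {p : M} {v : TangentSpace (𝓡 4) p} (h : ∀ w, g.val p v w = 0) : v = 0 := by
  obtain ⟨b, hb⟩ := g.signature p
  refine b.ext_elem fun j ↦ ?_
  have h1 := h (b j)
  rw [← b.sum_repr v] at h1
  simp only [map_sum, sum_apply, map_smul, smul_apply, hb, smul_eq_mul] at h1
  simp only [mul_ite, mul_one, mul_neg, mul_zero, Finset.sum_ite_eq', Finset.mem_univ,
    if_true] at h1
  simp only [map_zero, Finsupp.coe_zero, Pi.zero_apply]
  split_ifs at h1 <;> linarith

/-- A kernel vector of the matrix would be orthogonal to every tangent vector. The centre of the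
chart suffices, since covariant derivatives are always computed in the chart around their own base
point. -/
lemma isUnit_det_coeff_self (q : M) : IsUnit (g.coeff q (extChartAt (𝓡 4) q q)).det := by
  rw [isUnit_iff_ne_zero]
  intro h
  obtain ⟨v, hv, hv0⟩ := Matrix.exists_mulVec_eq_zero_iff.2 h
  refine hv ?_
  have h2 : (comp q).symm (WithLp.toLp 2 v : E4) = 0 := by
    refine g.nondegenerate (p := q) fun w ↦ ?_
    rw [g.symm, g.val_eq_sum_coeff_self q w]
    have : ∀ i, ∑ j, g.coeff q (extChartAt (𝓡 4) q q) i j * v j = 0 := fun i ↦ congrFun hv0 i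
    refine Finset.sum_eq_zero fun i _ ↦ ?_
    calc _ = comp q w i * ∑ j, g.coeff q (extChartAt (𝓡 4) q q) i j * v j := by
          rw [Finset.mul_sum]; exact Finset.sum_congr rfl fun j _ ↦ by simp; ring
      _ = 0 := by rw [this, mul_zero]
  simpa using h2

end LorentzMetric
end
end EntropyBound

/-! ### The covariant derivative along a map: torsion-freeness and metric compatibility. -/

namespace EntropyBound

/-- The domain on which a map can be read in the chart around `q`. -/
lemma isOpen_inter_preimage_source {M : Type*} [TopologicalSpace M] [ChartedSpace E4 M]
    {F : Type*} [NormedAddCommGroup F] [NormedSpace ℝ F] {Φ : F → M} {W : Set F} (hW : IsOpen W)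
    (hΦ : ContMDiffOn 𝓘(ℝ, F) (𝓡 4) ∞ Φ W) (q : M) : IsOpen (W ∩ Φ ⁻¹' (extChartAt (𝓡 4) q).source) :=
  hΦ.continuousOn.isOpen_inter_preimage hW (isOpen_extChartAt_source q)

section
variable {M : Type*} [TopologicalSpace M] [ChartedSpace E4 M] [IsManifold (𝓡 4) ∞ M]

section
variable {F : Type*} [NormedAddCommGroup F] [NormedSpace ℝ F] {Φ : F → M} {W : Set F}

lemma contDiffOn_chart_comp (hΦ : ContMDiffOn 𝓘(ℝ, F) (𝓡 4) ∞ Φ W) (q : M) :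
    ContDiffOn ℝ ∞ (fun z ↦ extChartAt (𝓡 4) q (Φ z))
      (W ∩ Φ ⁻¹' (extChartAt (𝓡 4) q).source) := by
  rw [← contMDiffOn_iff_contDiffOn]
  refine (contMDiffOn_extChartAt (I := 𝓡 4) (x := q)).comp (hΦ.mono Set.inter_subset_left) ?_
  intro z hz
  simpa using hz.2

lemma contDiffAt_chart_comp (hW : IsOpen W) (hΦ : ContMDiffOn 𝓘(ℝ, F) (𝓡 4) ∞ Φ W) {q : M}
    {z : F} (hz : z ∈ W) (hq : Φ z ∈ (extChartAt (𝓡 4) q).source) :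
    ContDiffAt ℝ ∞ (fun z ↦ extChartAt (𝓡 4) q (Φ z)) z :=
  (contDiffOn_chart_comp hΦ q).contDiffAt
    ((isOpen_inter_preimage_source hW hΦ q).mem_nhds ⟨hz, hq⟩)

lemma chartVec_mfderiv (hW : IsOpen W) (hΦ : ContMDiffOn 𝓘(ℝ, F) (𝓡 4) ∞ Φ W) {q : M}
    {z : F} (hz : z ∈ W) (hq : Φ z ∈ (extChartAt (𝓡 4) q).source) (v : F) :
    chartVec q (Φ z) (mfderiv 𝓘(ℝ, F) (𝓡 4) Φ z v) =
      fderiv ℝ (fun z' ↦ extChartAt (𝓡 4) q (Φ z')) z v := by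
  have : IsManifold (𝓡 4) 1 M := .of_le (n := ∞) (by simp)
  have h1 : MDifferentiableAt 𝓘(ℝ, F) (𝓡 4) Φ z :=
    (hΦ.contMDiffAt (hW.mem_nhds hz)).mdifferentiableAt (by simp)
  have h2 : MDifferentiableAt (𝓡 4) 𝓘(ℝ, E4) (extChartAt (𝓡 4) q) (Φ z) :=
    mdifferentiableAt_extChartAt (by simpa using hq)
  have h := mfderiv_comp z h2 h1
  rw [mfderiv_eq_fderiv] at h
  exact (DFunLike.congr_fun h v).symm

lemma comp_mfderiv (hW : IsOpen W) (hΦ : ContMDiffOn 𝓘(ℝ, F) (𝓡 4) ∞ Φ W)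
    {z : F} (hz : z ∈ W) (v : F) :
    comp (Φ z) (mfderiv 𝓘(ℝ, F) (𝓡 4) Φ z v) =
      fderiv ℝ (fun z' ↦ extChartAt (𝓡 4) (Φ z) (Φ z')) z v := by
  rw [← chartVec_self, chartVec_mfderiv hW hΦ hz (mem_extChartAt_source _)]

lemma differentiableAt_fderiv_chart (hW : IsOpen W) (hΦ : ContMDiffOn 𝓘(ℝ, F) (𝓡 4) ∞ Φ W)
    {q : M} {z : F} (hz : z ∈ W) (hq : Φ z ∈ (extChartAt (𝓡 4) q).source) :
    DifferentiableAt ℝ (fderiv ℝ (fun z' ↦ extChartAt (𝓡 4) q (Φ z'))) z :=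
  ((contDiffAt_chart_comp hW hΦ hz hq).fderiv_right (m := 1)
    (WithTop.coe_le_coe.2 (le_top (a := (1 + 1 : ℕ∞))))).differentiableAt
    (by simp)

lemma differentiableAt_fderiv_chart_apply (hW : IsOpen W)
    (hΦ : ContMDiffOn 𝓘(ℝ, F) (𝓡 4) ∞ Φ W) {q : M} {z : F} (hz : z ∈ W)
    (hq : Φ z ∈ (extChartAt (𝓡 4) q).source) (v : F) (i : Fin 4) :
    DifferentiableAt ℝ (fun z' ↦ fderiv ℝ (fun z' ↦ extChartAt (𝓡 4) q (Φ z')) z' v i) z :=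
  (EuclideanSpace.proj (𝕜 := ℝ) i).differentiableAt.comp z
    ((differentiableAt_fderiv_chart hW hΦ hz hq).clm_apply (differentiableAt_const v))

end

namespace LorentzMetric
variable (g : LorentzMetric M)

lemma christoffel_symm (q : M) (y : E4) (i j l : Fin 4) :
    g.christoffel q y i j l = g.christoffel q y i l j := by
  simp only [christoffel]
  congr 1
  refine Finset.sum_congr rfl fun m _ ↦ ?_
  rw [g.dcoeff_symm q y m j l]; ring

lemma connection_symm (q : M) (y u a : E4) (i : Fin 4) :
    g.connection q y u a i = g.connection q y a u i := by
  simp only [connection]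
  rw [Finset.sum_comm]
  refine Finset.sum_congr rfl fun j _ ↦ Finset.sum_congr rfl fun l _ ↦ ?_
  rw [g.christoffel_symm]; ring

variable {Φ : Param → M} {W : Set Param}

lemma comp_covDerivAlong (Φ : Param → M) (z v w : Param) (i : Fin 4) :
    comp (Φ z) (g.covDerivAlong Φ z v w) i =
      fderiv ℝ (fun z' ↦ fderiv ℝ (fun z' ↦ extChartAt (𝓡 4) (Φ z) (Φ z')) z' w i) z v +
        g.connection (Φ z) (extChartAt (𝓡 4) (Φ z) (Φ z))
          (fderiv ℝ (fun z' ↦ extChartAt (𝓡 4) (Φ z) (Φ z')) z v)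
          (fderiv ℝ (fun z' ↦ extChartAt (𝓡 4) (Φ z) (Φ z')) z w) i := rfl

/-- The Levi-Civita connection is torsion-free. -/
lemma covDerivAlong_symm (hW : IsOpen W) (hΦ : ContMDiffOn 𝓘(ℝ, Param) (𝓡 4) ∞ Φ W)
    {z : Param} (hz : z ∈ W) (v w : Param) :
    g.covDerivAlong Φ z v w = g.covDerivAlong Φ z w v := by
  apply (comp (Φ z)).injective
  ext i
  rw [comp_covDerivAlong, comp_covDerivAlong, g.connection_symm]
  congr 1
  have hq := mem_extChartAt_source (I := 𝓡 4) (Φ z)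
  have hd := differentiableAt_fderiv_chart hW hΦ hz hq
  -- Iterated directional derivatives are values of the second derivative, whose symmetry then
  -- applies.
  have key : ∀ v w : Param,
      fderiv ℝ (fun z' ↦ fderiv ℝ (fun z' ↦ extChartAt (𝓡 4) (Φ z) (Φ z')) z' w i) z v =
      fderiv ℝ (fderiv ℝ (fun z' ↦ extChartAt (𝓡 4) (Φ z) (Φ z'))) z v w i := by
    intro v w
    have h := (EuclideanSpace.proj (𝕜 := ℝ) i : E4 →L[ℝ] ℝ).hasFDerivAt.comp z
      (hd.hasFDerivAt.clm_apply (hasFDerivAt_const w z))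
    exact (DFunLike.congr_fun h.fderiv v).trans (by simp)
  rw [key, key]
  have hs : IsSymmSndFDerivAt ℝ (fun z' ↦ extChartAt (𝓡 4) (Φ z) (Φ z')) z :=
    (contDiffAt_chart_comp hW hΦ hz hq).isSymmSndFDerivAt (by simpa using WithTop.coe_le_coe.2 (le_top (a := (2 : ℕ∞))))
  rw [hs v w]

/-- The Levi-Civita connection is compatible with the metric. -/
lemma fderiv_val (hW : IsOpen W) (hΦ : ContMDiffOn 𝓘(ℝ, Param) (𝓡 4) ∞ Φ W)
    {z : Param} (hz : z ∈ W) (u v w : Param) :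
    fderiv ℝ (fun z' ↦ g.val (Φ z') (mfderiv 𝓘(ℝ, Param) (𝓡 4) Φ z' v)
      (mfderiv 𝓘(ℝ, Param) (𝓡 4) Φ z' w)) z u =
      g.val (Φ z) (g.covDerivAlong Φ z u v) (mfderiv 𝓘(ℝ, Param) (𝓡 4) Φ z w) +
      g.val (Φ z) (mfderiv 𝓘(ℝ, Param) (𝓡 4) Φ z v) (g.covDerivAlong Φ z u w) := by
  have hq := mem_extChartAt_source (I := 𝓡 4) (Φ z)
  -- The chart is frozen at `Φ z` while `z'` varies, so that both sides can be differentiated in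
  -- coordinates.
  have hev : (fun z' ↦ g.val (Φ z') (mfderiv 𝓘(ℝ, Param) (𝓡 4) Φ z' v)
      (mfderiv 𝓘(ℝ, Param) (𝓡 4) Φ z' w)) =ᶠ[𝓝 z] fun z' ↦
      ∑ i, ∑ j, g.coeff (Φ z) (extChartAt (𝓡 4) (Φ z) (Φ z')) i j *
        fderiv ℝ (fun z' ↦ extChartAt (𝓡 4) (Φ z) (Φ z')) z' v i *
        fderiv ℝ (fun z' ↦ extChartAt (𝓡 4) (Φ z) (Φ z')) z' w j := by
    filter_upwards [(isOpen_inter_preimage_source hW hΦ (Φ z)).mem_nhds ⟨hz, hq⟩] with z' hz'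
    rw [g.val_eq_sum_coeff hz'.2, chartVec_mfderiv hW hΦ hz'.1 hz'.2,
      chartVec_mfderiv hW hΦ hz'.1 hz'.2]
  rw [hev.fderiv_eq, g.fderiv_sum_coeff
    (ψ := fun z' ↦ extChartAt (𝓡 4) (Φ z) (Φ z')) (g.isUnit_det_coeff_self (Φ z))
    (fun i j ↦ g.differentiableAt_coeff _ i j (mem_extChartAt_target (Φ z)))
    ((contDiffAt_chart_comp hW hΦ hz hq).differentiableAt (by simp))
    (differentiableAt_fderiv_chart_apply hW hΦ hz hq v)
    (differentiableAt_fderiv_chart_apply hW hΦ hz hq w),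
    g.val_eq_sum_coeff_self, g.val_eq_sum_coeff_self]
  simp only [comp_covDerivAlong, comp_mfderiv hW hΦ hz]

/-- The inner products of coordinate vectors are smooth functions. -/
lemma contDiffOn_val_mfderiv (hW : IsOpen W) (hΦ : ContMDiffOn 𝓘(ℝ, Param) (𝓡 4) ∞ Φ W)
    (v w : Param) :
    ContDiffOn ℝ ∞ (fun z' ↦ g.val (Φ z') (mfderiv 𝓘(ℝ, Param) (𝓡 4) Φ z' v)
      (mfderiv 𝓘(ℝ, Param) (𝓡 4) Φ z' w)) W := fun z hz ↦
  g.contDiffWithinAt_val (n := ⊤) (contMDiffOn_mfderiv_apply hW hΦ v z hz)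
    (contMDiffOn_mfderiv_apply hW hΦ w z hz)

end LorentzMetric
end
end EntropyBound

/-! ### The area element, its relation to the expansion, and tilted sections. -/

namespace EntropyBound
section
variable {M : Type*} [TopologicalSpace M] [ChartedSpace E4 M] [IsManifold (𝓡 4) ∞ M]

/-- The area element of the cross-sections `lam = const`. -/
noncomputable def areaDensity (g : LorentzMetric M) (Φ : Param → M) (z : Param) : ℝ :=
  Real.sqrt (sectionMetric g Φ z).det

variable {g : LorentzMetric M} {Φ : Param → M} {W : Set Param}

lemma areaDensity_pos {z : Param} (hpos : (sectionMetric g Φ z).PosDef) :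
    0 < areaDensity g Φ z :=
  Real.sqrt_pos.2 hpos.det_pos

lemma contDiffOn_sectionMetric (hW : IsOpen W) (hΦ : ContMDiffOn 𝓘(ℝ, Param) (𝓡 4) ∞ Φ W)
    (A B : Fin 2) : ContDiffOn ℝ ∞ (fun z ↦ sectionMetric g Φ z A B) W :=
  g.contDiffOn_val_mfderiv hW hΦ (dirX A) (dirX B)

lemma contDiffAt_areaDensity (hW : IsOpen W) (hΦ : ContMDiffOn 𝓘(ℝ, Param) (𝓡 4) ∞ Φ W)
    {z : Param} (hz : z ∈ W) (hpos : (sectionMetric g Φ z).PosDef) :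
    ContDiffAt ℝ ∞ (areaDensity g Φ) z := by
  have h : ∀ A B, ContDiffAt ℝ ∞ (fun z ↦ sectionMetric g Φ z A B) z := fun A B ↦
    (contDiffOn_sectionMetric hW hΦ A B).contDiffAt (hW.mem_nhds hz)
  have hdet : ContDiffAt ℝ ∞ (fun z ↦ (sectionMetric g Φ z).det) z := by
    simp only [Matrix.det_fin_two]
    exact ((h 0 0).mul (h 1 1)).sub ((h 0 1).mul (h 1 0))
  exact hdet.sqrt hpos.det_pos.ne'

/-- The expansion is the logarithmic derivative of the area element along the generators. -/
lemma fderiv_areaDensity (hW : IsOpen W) (hΦ : ContMDiffOn 𝓘(ℝ, Param) (𝓡 4) ∞ Φ W)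
    {z : Param} (hz : z ∈ W) (hpos : (sectionMetric g Φ z).PosDef) :
    fderiv ℝ (areaDensity g Φ) z dirL = expansion g Φ z * areaDensity g Φ z := by
  have hdiff : ∀ A B, DifferentiableAt ℝ (fun z ↦ sectionMetric g Φ z A B) z := fun A B ↦
    ((contDiffOn_sectionMetric hW hΦ A B).contDiffAt (hW.mem_nhds hz)).differentiableAt (by simp)
  set t : Fin 2 → Fin 2 → ℝ := fun A B ↦
    g.val (Φ z) (g.covDerivAlong Φ z (dirX A) dirL) (tangentX Φ B z) with ht
  -- Metric compatibility produces `D_λ ∂_A`, and torsion-freeness turns it into `D_A k`.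
  have hd : ∀ A B, fderiv ℝ (fun z ↦ sectionMetric g Φ z A B) z dirL = t A B + t B A := by
    intro A B
    have h := g.fderiv_val hW hΦ hz dirL (dirX A) (dirX B)
    rw [g.covDerivAlong_symm hW hΦ hz dirL, g.covDerivAlong_symm hW hΦ hz dirL,
      g.symm (Φ z) (mfderiv 𝓘(ℝ, Param) (𝓡 4) Φ z (dirX A))] at h
    exact h
  have hdet : fderiv ℝ (fun z ↦ (sectionMetric g Φ z).det) z dirL =
      (t 0 0 + t 0 0) * sectionMetric g Φ z 1 1 + sectionMetric g Φ z 0 0 * (t 1 1 + t 1 1) -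
      ((t 0 1 + t 1 0) * sectionMetric g Φ z 1 0 + sectionMetric g Φ z 0 1 * (t 1 0 + t 0 1)) := by
    have h := ((hdiff 0 0).hasFDerivAt.mul (hdiff 1 1).hasFDerivAt).sub
        ((hdiff 0 1).hasFDerivAt.mul (hdiff 1 0).hasFDerivAt)
    simp only [Matrix.det_fin_two]
    refine (DFunLike.congr_fun h.fderiv dirL).trans ?_
    simp only [sub_apply, add_apply, smul_apply, smul_eq_mul, hd]
    ring
  have hdetd : DifferentiableAt ℝ (fun z ↦ (sectionMetric g Φ z).det) z := by
    simp only [Matrix.det_fin_two]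
    exact ((hdiff 0 0).mul (hdiff 1 1)).sub ((hdiff 0 1).mul (hdiff 1 0))
  have hs : sectionMetric g Φ z 1 0 = sectionMetric g Φ z 0 1 := g.symm _ _ _
  have hD := hpos.det_pos
  -- By the adjugate formula for the inverse, `θ det h` is half of `∂_λ det h`; the square root
  -- supplies the matching factor `1/2`.
  have hexp : expansion g Φ z * (sectionMetric g Φ z).det = sectionMetric g Φ z 1 1 * t 0 0 -
      sectionMetric g Φ z 0 1 * (t 0 1 + t 1 0) + sectionMetric g Φ z 0 0 * t 1 1 := by
    have h1 : expansion g Φ z = ∑ A, ∑ B, (sectionMetric g Φ z)⁻¹ A B * t A B := rfl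
    rw [h1, Matrix.inv_def, Matrix.adjugate_fin_two, Ring.inverse_eq_inv']
    simp only [Fin.sum_univ_two, Matrix.smul_apply, smul_eq_mul, Matrix.of_apply,
      Matrix.cons_val', Matrix.cons_val_zero, Matrix.cons_val_one, Matrix.cons_val_fin_one, hs]
    field_simp
    ring
  have h2 : fderiv ℝ (areaDensity g Φ) z dirL =
      1 / (2 * areaDensity g Φ z) * fderiv ℝ (fun z ↦ (sectionMetric g Φ z).det) z dirL := by
    have h := hdetd.hasFDerivAt.sqrt hD.ne'
    exact DFunLike.congr_fun h.fderiv dirL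
  have hsq : areaDensity g Φ z ^ 2 = (sectionMetric g Φ z).det := Real.sq_sqrt hD.le
  have ha := areaDensity_pos hpos
  rw [h2, hdet, hs, one_div, inv_mul_eq_iff_eq_mul₀ (by positivity)]
  calc _ = 2 * (expansion g Φ z * (sectionMetric g Φ z).det) := by rw [hexp]; ring
    _ = _ := by rw [← hsq]; ring

/-- The induced metric of a section of a null hypersurface does not depend on how the section is
tilted along the generators. -/
lemma inducedMetric_section (hW : IsOpen W) (hΦ : ContMDiffOn 𝓘(ℝ, Param) (𝓡 4) ∞ Φ W)
    {f : (Fin 2 → ℝ) → ℝ} {x : Fin 2 → ℝ} (hx : (x, f x) ∈ W) (hf : DifferentiableAt ℝ f x)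
    (hnull : g.val (Φ (x, f x)) (generator Φ (x, f x)) (generator Φ (x, f x)) = 0)
    (hnormal : ∀ A, g.val (Φ (x, f x)) (generator Φ (x, f x)) (tangentX Φ A (x, f x)) = 0) :
    g.inducedMetric (fun x ↦ Φ (x, f x)) x = sectionMetric g Φ (x, f x) := by
  have h1 : MDifferentiableAt 𝓘(ℝ, Param) (𝓡 4) Φ (x, f x) :=
    (hΦ.contMDiffAt (hW.mem_nhds hx)).mdifferentiableAt (by simp)
  have h2 : HasFDerivAt (fun x ↦ ((x, f x) : Param))
      ((ContinuousLinearMap.id ℝ _).prod (fderiv ℝ f x)) x :=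
    (hasFDerivAt_id x).prodMk hf.hasFDerivAt
  -- Tilting adds to each tangent vector a multiple of `k`, which is null and orthogonal to every
  -- `∂_A`, so it drops out of all inner products.
  have h3 : ∀ v : Fin 2 → ℝ, mfderiv 𝓘(ℝ, Fin 2 → ℝ) (𝓡 4) (fun x ↦ Φ (x, f x)) x v =
      mfderiv 𝓘(ℝ, Param) (𝓡 4) Φ (x, f x) (v, 0) +
        fderiv ℝ f x v • generator Φ (x, f x) := by
    intro v
    have h := (h1.hasMFDerivAt.comp x h2.hasMFDerivAt).mfderiv
    have h' : mfderiv 𝓘(ℝ, Fin 2 → ℝ) (𝓡 4) (fun x ↦ Φ (x, f x)) x v =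
      mfderiv 𝓘(ℝ, Param) (𝓡 4) Φ (x, f x) (v, fderiv ℝ f x v) := DFunLike.congr_fun h v
    rw [h']
    let T : Param →L[ℝ] E4 := mfderiv 𝓘(ℝ, Param) (𝓡 4) Φ (x, f x)
    have hT : T (v, fderiv ℝ f x v) = T (v, 0) + fderiv ℝ f x v • T dirL := by
      rw [← map_smul, ← map_add]
      congr 1
      ext <;> simp [dirL]
    exact hT
  ext A B
  simp only [LorentzMetric.inducedMetric, sectionMetric, Matrix.of_apply]
  erw [h3, h3]
  have hn' := fun A ↦ (g.symm _ _ _).trans (hnormal A)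
  have e : ∀ A, mfderiv 𝓘(ℝ, Param) (𝓡 4) Φ (x, f x) (Pi.single A 1, 0) =
    tangentX Φ A (x, f x) := fun A ↦ rfl
  rw [e, e]
  simp only [map_add, map_smul, add_apply, smul_apply, smul_eq_mul, hnull, hnormal, hn', mul_zero,
    add_zero]

end
end EntropyBound

/-! ### Local injectivity and integrals with a variable endpoint. -/

namespace EntropyBound

/-- A map with an injective strict derivative is injective near the point. -/
lemma exists_isOpen_injOn_of_hasStrictFDerivAt {E F : Type*} [NormedAddCommGroup E]
    [NormedSpace ℝ E] [CompleteSpace E] [NormedAddCommGroup F] [NormedSpace ℝ F]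
    [FiniteDimensional ℝ F] {f : E → F} {f' : E →L[ℝ] F} {x : E}
    (hf : HasStrictFDerivAt f f' x) (hinj : Function.Injective f') :
    ∃ O : Set E, IsOpen O ∧ x ∈ O ∧ Set.InjOn f O := by
  -- Composing with a left inverse of `f'` gives a map whose derivative is the identity, to which
  -- the inverse function theorem applies.
  obtain ⟨P, hP⟩ := (f' : E →ₗ[ℝ] F).exists_leftInverse_of_injective
    (LinearMap.ker_eq_bot.2 hinj)
  have h1 : HasStrictFDerivAt (fun y ↦ LinearMap.toContinuousLinearMap P (f y))
      ((ContinuousLinearEquiv.refl ℝ E : E ≃L[ℝ] E) : E →L[ℝ] E) x := by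
    have h2 := (LinearMap.toContinuousLinearMap P).hasStrictFDerivAt.comp x hf
    convert! h2 using 1
    ext v
    exact (DFunLike.congr_fun hP v).symm
  refine ⟨(h1.toOpenPartialHomeomorph _).source, (h1.toOpenPartialHomeomorph _).open_source,
    h1.mem_toOpenPartialHomeomorph_source, fun a ha b hb hab ↦ ?_⟩
  refine (h1.toOpenPartialHomeomorph _).injOn ha hb ?_
  simp only [HasStrictFDerivAt.toOpenPartialHomeomorph_coe, hab]

/-- An integral over a variable interval depends continuously on the parameter. -/
lemma continuousOn_intervalIntegral_endpoint {X : Type*} [TopologicalSpace X]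
    [FirstCountableTopology X] {D : Set X} {e : X → ℝ} (he : ContinuousOn e D)
    (hpos : ∀ x ∈ D, 0 < e x) {f : X × ℝ → ℝ}
    (hf : ContinuousOn f {z | z.1 ∈ D ∧ 0 ≤ z.2 ∧ z.2 ≤ e z.1}) :
    ContinuousOn (fun x ↦ ∫ l in (0 : ℝ)..(e x), f (x, l)) D := by
  rw [continuousOn_iff_continuous_domRestrict]
  have he' : Continuous fun x : D ↦ e x := continuousOn_iff_continuous_domRestrict.1 he
  -- The substitution `l = e x * u` fixes the interval as `[0, 1]`. Clamping `u` by `projIcc` keeps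
  -- the argument where `f` is known to be continuous.
  have hc : Continuous fun p : D × ℝ ↦
      f (p.1, e p.1 * (Set.projIcc (0 : ℝ) 1 zero_le_one p.2 : ℝ)) := by
    refine hf.comp_continuous (f := fun p : D × ℝ ↦
      ((p.1 : X), e p.1 * (Set.projIcc (0 : ℝ) 1 zero_le_one p.2 : ℝ))) ?_ ?_
    · exact (continuous_subtype_val.comp continuous_fst).prodMk ((he'.comp continuous_fst).mul
        (continuous_subtype_val.comp (continuous_projIcc.comp continuous_snd)))
    · rintro ⟨x, u⟩
      have h := (Set.projIcc (0 : ℝ) 1 zero_le_one u).2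
      have h0 := hpos x x.2
      exact ⟨x.2, mul_nonneg h0.le h.1, mul_le_of_le_one_right h0.le h.2⟩
  have hI := (intervalIntegral.continuous_parametric_intervalIntegral_of_continuous'
    (μ := MeasureTheory.volume) (f := fun (x : D) (u : ℝ) ↦
      f (x, e x * (Set.projIcc (0 : ℝ) 1 zero_le_one u : ℝ))) hc 0 1)
  refine (he'.mul hI).congr fun x ↦ ?_
  have h0 := hpos x x.2
  have h1 : ∫ u in (0 : ℝ)..1, f (x, e x * (Set.projIcc (0 : ℝ) 1 zero_le_one u : ℝ)) =
      ∫ u in (0 : ℝ)..1, f (x, e x * u) := by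
    refine intervalIntegral.integral_congr fun u hu ↦ ?_
    rw [Set.uIcc_of_le zero_le_one] at hu
    simp only [Set.projIcc_of_mem zero_le_one hu]
  change e x * (∫ u in (0 : ℝ)..1, f (x, e x * (Set.projIcc (0 : ℝ) 1 zero_le_one u : ℝ))) =
    ∫ l in (0 : ℝ)..(e x), f (x, l)
  rw [h1, intervalIntegral.integral_comp_mul_left (fun l ↦ f (x, l)) h0.ne']
  simp [h0.ne']

/-! ### The defect of the entropy bound as an integral of the surplus. -/

section
variable {M : Type*} [TopologicalSpace M] [ChartedSpace E4 M] [IsManifold (𝓡 4) ∞ M]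

namespace LightSheet
variable {g : LorentzMetric M} (L : LightSheet g)

lemma continuousOn_endpoint : ContinuousOn L.endpoint L.D := by
  obtain ⟨V, -, hDV, hV⟩ := L.endpoint_smooth
  exact hV.continuousOn.mono hDV

lemma differentiableAt_endpoint {x : Fin 2 → ℝ} (hx : x ∈ L.D) :
    DifferentiableAt ℝ L.endpoint x := by
  obtain ⟨V, hVo, hDV, hV⟩ := L.endpoint_smooth
  exact (hV.contDiffAt (hVo.mem_nhds (hDV hx))).differentiableAt (by simp)

lemma contDiffAt_areaDensity {z : Param} (hz : z ∈ L.params) :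
    ContDiffAt ℝ ∞ (areaDensity g L.Φ) z := by
  obtain ⟨W, hW, hsub, hΦ⟩ := L.smooth
  exact EntropyBound.contDiffAt_areaDensity hW hΦ (hsub hz) (L.spacelike z hz.1 hz.2.1 hz.2.2)

lemma areaDensity_pos {z : Param} (hz : z ∈ L.params) : 0 < areaDensity g L.Φ z :=
  EntropyBound.areaDensity_pos (L.spacelike z hz.1 hz.2.1 hz.2.2)

lemma continuousOn_areaDensity : ContinuousOn (areaDensity g L.Φ) L.params := fun _ hz ↦
  (L.contDiffAt_areaDensity hz).continuousAt.continuousWithinAt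

lemma fderiv_areaDensity {z : Param} (hz : z ∈ L.params) :
    fderiv ℝ (areaDensity g L.Φ) z dirL = expansion g L.Φ z * areaDensity g L.Φ z := by
  obtain ⟨W, hW, hsub, hΦ⟩ := L.smooth
  exact EntropyBound.fderiv_areaDensity hW hΦ (hsub hz) (L.spacelike z hz.1 hz.2.1 hz.2.2)

/-- The defining formula uses a chart that changes with the point, so continuity is read off instead
from `θ = ∂_λ √det h / √det h`. -/
lemma continuousOn_expansion : ContinuousOn (expansion g L.Φ) L.params := by
  have h : ContinuousOn (fun z ↦ fderiv ℝ (areaDensity g L.Φ) z dirL / areaDensity g L.Φ z)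
      L.params := by
    refine ContinuousOn.div (fun z hz ↦ ?_) L.continuousOn_areaDensity
      fun z hz ↦ (L.areaDensity_pos hz).ne'
    exact (((L.contDiffAt_areaDensity hz).continuousAt_fderiv (by simp)).clm_apply
      continuousAt_const).continuousWithinAt
  refine h.congr fun z hz ↦ ?_
  simp only
  rw [L.fderiv_areaDensity hz, mul_div_cancel_right₀ _ (L.areaDensity_pos hz).ne']

lemma continuousOn_flux {S : ∀ p : M, TangentSpace (𝓡 4) p} {U : Set M}
    (hS : ContinuousOn (fun p ↦ (⟨p, S p⟩ : TangentBundle (𝓡 4) M)) U) :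
    ContinuousOn (L.flux S) (L.params ∩ L.Φ ⁻¹' U) := by
  obtain ⟨W, hW, hsub, hΦ⟩ := L.smooth
  have : IsManifold (𝓡 4) 1 M := .of_le (n := ∞) (by simp)
  have hk := (contMDiffOn_mfderiv_apply hW hΦ dirL).mono
    (Set.inter_subset_left.trans hsub : L.params ∩ L.Φ ⁻¹' U ⊆ W)
  have hS' : ContinuousOn (fun z ↦ (⟨L.Φ z, S (L.Φ z)⟩ : TangentBundle (𝓡 4) M))
      (L.params ∩ L.Φ ⁻¹' U) :=
    hS.comp (hΦ.continuousOn.mono (Set.inter_subset_left.trans hsub)) fun z hz ↦ hz.2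
  intro z hz
  refine ContinuousWithinAt.neg ?_
  -- Order `0` is plain continuity, which is all that is known of `S`.
  refine (g.contDiffWithinAt_val (n := 0) (Φ := L.Φ) (v := fun z ↦ generator L.Φ z)
    (w := fun z ↦ S (L.Φ z)) ((hk z hz).of_le (by simp)) ?_).continuousWithinAt
  exact contMDiffOn_zero_iff.2 hS' z hz

/-- The surplus `s + θ/4` of the entropy flux over its bound. -/
noncomputable def surplus (S : ∀ p : M, TangentSpace (𝓡 4) p) (z : Param) : ℝ :=
  L.flux S z + (1 / 4) * expansion g L.Φ z

lemma continuousOn_surplus {S : ∀ p : M, TangentSpace (𝓡 4) p} {U : Set M}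
    (hS : ContinuousOn (fun p ↦ (⟨p, S p⟩ : TangentBundle (𝓡 4) M)) U) :
    ContinuousOn (L.surplus S) (L.params ∩ L.Φ ⁻¹' U) :=
  (L.continuousOn_flux hS).add
    (continuousOn_const.mul (L.continuousOn_expansion.mono Set.inter_subset_left))

lemma areaB_eq : L.areaB = ∫ x in L.D, areaDensity g L.Φ (x, 0) := by
  obtain ⟨W, hW, hsub, hΦ⟩ := L.smooth
  refine MeasureTheory.setIntegral_congr_fun L.isCompact.measurableSet fun x hx ↦ ?_
  have h0 := (L.endpoint_pos x hx).le
  simp only [areaDensity]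
  rw [inducedMetric_section (f := fun _ ↦ 0) hW hΦ (hsub ⟨hx, le_rfl, h0⟩)
    (differentiableAt_const _) (L.null _ hx le_rfl h0) (L.normal _ hx le_rfl h0)]

/-- `B'` is in general not a section of constant `λ`; `inducedMetric_section` shows that the tilt
does not affect its area element. -/
lemma areaB'_eq : L.areaB' = ∫ x in L.D, areaDensity g L.Φ (x, L.endpoint x) := by
  obtain ⟨W, hW, hsub, hΦ⟩ := L.smooth
  refine MeasureTheory.setIntegral_congr_fun L.isCompact.measurableSet fun x hx ↦ ?_
  have h0 := (L.endpoint_pos x hx).le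
  simp only [areaDensity]
  rw [inducedMetric_section hW hΦ (hsub ⟨hx, h0, le_rfl⟩)
    (L.differentiableAt_endpoint hx) (L.null _ hx h0 le_rfl) (L.normal _ hx h0 le_rfl)]

lemma mapsTo_fiber {x : Fin 2 → ℝ} (hx : x ∈ L.D) :
    Set.MapsTo (fun l : ℝ ↦ (x, l)) (Set.uIcc 0 (L.endpoint x)) L.params := by
  intro l hl
  rw [Set.uIcc_of_le (L.endpoint_pos x hx).le] at hl
  exact ⟨hx, hl⟩

lemma intervalIntegrable_fiber {f : Param → ℝ} (hf : ContinuousOn f L.params)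
    {x : Fin 2 → ℝ} (hx : x ∈ L.D) :
    IntervalIntegrable (fun l ↦ f (x, l)) MeasureTheory.volume 0 (L.endpoint x) :=
  (hf.comp (by fun_prop) (L.mapsTo_fiber hx)).intervalIntegrable

lemma continuousOn_expansion_mul :
    ContinuousOn (fun z ↦ expansion g L.Φ z * areaDensity g L.Φ z) L.params :=
  L.continuousOn_expansion.mul L.continuousOn_areaDensity

/-- The decrease of the area element along a generator. -/
lemma integral_expansion {x : Fin 2 → ℝ} (hx : x ∈ L.D) :
    ∫ l in (0 : ℝ)..(L.endpoint x), expansion g L.Φ (x, l) * areaDensity g L.Φ (x, l) =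
      areaDensity g L.Φ (x, L.endpoint x) - areaDensity g L.Φ (x, 0) := by
  refine intervalIntegral.integral_eq_sub_of_hasDerivAt
    (f := fun l ↦ areaDensity g L.Φ (x, l)) (fun l hl ↦ ?_)
    (L.intervalIntegrable_fiber L.continuousOn_expansion_mul hx)
  have hz := L.mapsTo_fiber hx hl
  have h1 : HasFDerivAt (areaDensity g L.Φ) (fderiv ℝ (areaDensity g L.Φ) (x, l)) (x, l) :=
    ((L.contDiffAt_areaDensity hz).differentiableAt (by simp)).hasFDerivAt
  have h2 : HasDerivAt (fun l : ℝ ↦ ((x, l) : Param)) dirL l :=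
    (hasDerivAt_const l x).prodMk (hasDerivAt_id l)
  rw [← L.fderiv_areaDensity hz]
  exact h1.comp_hasDerivAt l h2

lemma continuousOn_integral {f : Param → ℝ} (hf : ContinuousOn f L.params) :
    ContinuousOn (fun x ↦ ∫ l in (0 : ℝ)..(L.endpoint x), f (x, l)) L.D :=
  continuousOn_intervalIntegral_endpoint L.continuousOn_endpoint L.endpoint_pos hf

/-- The defect of the entropy bound is the integral of the surplus. -/
lemma entropy_sub_eq {S : ∀ p : M, TangentSpace (𝓡 4) p} {U : Set M}
    (hS : ContinuousOn (fun p ↦ (⟨p, S p⟩ : TangentBundle (𝓡 4) M)) U) (hU : L.carrier ⊆ U) :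
    L.entropy S - (1 / 4) * (L.areaB - L.areaB') =
      ∫ x in L.D, ∫ l in (0 : ℝ)..(L.endpoint x),
        L.surplus S (x, l) * areaDensity g L.Φ (x, l) := by
  have hsub : L.params ⊆ L.params ∩ L.Φ ⁻¹' U := fun z hz ↦ ⟨hz, hU ⟨z, hz, rfl⟩⟩
  have hflux : ContinuousOn (fun z ↦ L.flux S z * areaDensity g L.Φ z) L.params :=
    ((L.continuousOn_flux hS).mono hsub).mul L.continuousOn_areaDensity
  have hint : ∀ {f : (Fin 2 → ℝ) → ℝ}, ContinuousOn f L.D →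
      MeasureTheory.IntegrableOn f L.D := fun hf ↦ hf.integrableOn_compact L.isCompact
  have h0 : ContinuousOn (fun x ↦ areaDensity g L.Φ (x, 0)) L.D :=
    L.continuousOn_areaDensity.comp (by fun_prop)
      fun x hx ↦ ⟨hx, le_rfl, (L.endpoint_pos x hx).le⟩
  have h1 : ContinuousOn (fun x ↦ areaDensity g L.Φ (x, L.endpoint x)) L.D :=
    L.continuousOn_areaDensity.comp (continuousOn_id.prodMk L.continuousOn_endpoint)
      fun x hx ↦ ⟨hx, (L.endpoint_pos x hx).le, le_rfl⟩
  have h01 : MeasureTheory.IntegrableOn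
      (fun x ↦ areaDensity g L.Φ (x, 0) - areaDensity g L.Φ (x, L.endpoint x)) L.D :=
    hint (h0.sub h1)
  have hE : L.entropy S = ∫ x in L.D, ∫ l in (0 : ℝ)..(L.endpoint x),
      L.flux S (x, l) * areaDensity g L.Φ (x, l) := rfl
  rw [hE, L.areaB_eq, L.areaB'_eq, ← MeasureTheory.integral_sub (hint h0) (hint h1),
    ← MeasureTheory.integral_const_mul, ← MeasureTheory.integral_sub
      (hint (L.continuousOn_integral hflux)) (h01.const_mul (1 / 4))]
  refine MeasureTheory.setIntegral_congr_fun L.isCompact.measurableSet fun x hx ↦ ?_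
  -- The identity holds generator by generator: `∫ θ √det h dλ` is the change of the area element
  -- between the ends.
  have hth := L.integral_expansion hx
  have hadd := intervalIntegral.integral_add (L.intervalIntegrable_fiber hflux hx)
    ((L.intervalIntegrable_fiber L.continuousOn_expansion_mul hx).const_mul (1 / 4))
  rw [intervalIntegral.integral_const_mul, hth] at hadd
  calc _ = (∫ l in (0 : ℝ)..(L.endpoint x), L.flux S (x, l) * areaDensity g L.Φ (x, l)) +
        1 / 4 * (areaDensity g L.Φ (x, L.endpoint x) - areaDensity g L.Φ (x, 0)) := by ring
    _ = _ := by
      rw [← hadd]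
      refine intervalIntegral.integral_congr fun l _ ↦ ?_
      simp only [surplus]; ring

/-- The bound holds if the pointwise condition holds along the light sheet. -/
lemma entropyBoundHolds_of_surplus_nonpos {S : ∀ p : M, TangentSpace (𝓡 4) p} {U : Set M}
    (hS : ContinuousOn (fun p ↦ (⟨p, S p⟩ : TangentBundle (𝓡 4) M)) U) (hU : L.carrier ⊆ U)
    (h : ∀ z ∈ L.params, L.surplus S z ≤ 0) : L.EntropyBoundHolds S := by
  rw [EntropyBoundHolds, ← sub_nonpos, L.entropy_sub_eq hS hU]
  refine MeasureTheory.setIntegral_nonpos L.isCompact.measurableSet fun x hx ↦ ?_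
  rw [← neg_nonneg, ← intervalIntegral.integral_neg]
  refine intervalIntegral.integral_nonneg (L.endpoint_pos x hx).le fun l hl ↦ ?_
  have hz : (x, l) ∈ L.params := ⟨hx, hl⟩
  exact neg_nonneg.2 (mul_nonpos_of_nonpos_of_nonneg (h _ hz) (L.areaDensity_pos hz).le)

/-- The bound fails if the pointwise condition fails all along the light sheet. -/
lemma not_entropyBoundHolds_of_surplus_pos {S : ∀ p : M, TangentSpace (𝓡 4) p} {U : Set M}
    (hS : ContinuousOn (fun p ↦ (⟨p, S p⟩ : TangentBundle (𝓡 4) M)) U) (hU : L.carrier ⊆ U)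
    (hD : MeasureTheory.volume L.D ≠ 0) (h : ∀ z ∈ L.params, 0 < L.surplus S z) :
    ¬ L.EntropyBoundHolds S := by
  have hsub : L.params ⊆ L.params ∩ L.Φ ⁻¹' U := fun z hz ↦ ⟨hz, hU ⟨z, hz, rfl⟩⟩
  have hc : ContinuousOn (fun z ↦ L.surplus S z * areaDensity g L.Φ z) L.params :=
    ((L.continuousOn_surplus hS).mono hsub).mul L.continuousOn_areaDensity
  rw [EntropyBoundHolds, ← sub_nonpos, L.entropy_sub_eq hS hU, not_le]
  have hpos : ∀ x ∈ L.D, 0 < ∫ l in (0 : ℝ)..(L.endpoint x),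
      L.surplus S (x, l) * areaDensity g L.Φ (x, l) := by
    intro x hx
    refine intervalIntegral.intervalIntegral_pos_of_pos_on (L.intervalIntegrable_fiber hc hx)
      (fun l hl ↦ ?_) (L.endpoint_pos x hx)
    have hz : (x, l) ∈ L.params := ⟨hx, hl.1.le, hl.2.le⟩
    exact mul_pos (h _ hz) (L.areaDensity_pos hz)
  rw [MeasureTheory.setIntegral_pos_iff_support_of_nonneg_ae
    (MeasureTheory.ae_restrict_of_forall_mem L.isCompact.measurableSet fun x hx ↦ (hpos x hx).le)
    ((L.continuousOn_integral hc).integrableOn_compact L.isCompact)]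
  rw [Set.inter_eq_self_of_subset_right
    (fun x hx ↦ Function.mem_support.2 (hpos x hx).ne')]
  exact pos_iff_ne_zero.2 hD

end LightSheet
end
end EntropyBound

/-! ### Pieces of a light sheet, and the equivalence for a set of tangents. -/

namespace EntropyBound

lemma mfderiv_comp_add_right {M : Type*} [TopologicalSpace M] [ChartedSpace E4 M]
    {Φ : Param → M} {z c : Param}
    (h : MDifferentiableAt 𝓘(ℝ, Param) (𝓡 4) Φ (z + c)) (v : Param) :
    mfderiv 𝓘(ℝ, Param) (𝓡 4) (fun z ↦ Φ (z + c)) z v =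
      mfderiv 𝓘(ℝ, Param) (𝓡 4) Φ (z + c) v := by
  have h2 : HasFDerivAt (fun z : Param ↦ z + c) (ContinuousLinearMap.id ℝ Param) z :=
    (hasFDerivAt_id z).add_const c
  have h3 := (h.hasMFDerivAt.comp z h2.hasMFDerivAt).mfderiv
  exact DFunLike.congr_fun h3 v

section
variable {M : Type*} [TopologicalSpace M] [ChartedSpace E4 M] [IsManifold (𝓡 4) ∞ M]

/-- Both sides have the same base point, hence the same chart, and translation commutes with
parameter derivatives. This lets a piece of a sheet start at a later affine parameter. -/
lemma covDerivAlong_comp_add_right (g : LorentzMetric M) (Φ : Param → M) (z c v w : Param) :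
    g.covDerivAlong (fun z ↦ Φ (z + c)) z v w = g.covDerivAlong Φ (z + c) v w := by
  simp only [LorentzMetric.covDerivAlong]
  have h1 := fderiv_comp_add_right (𝕜 := ℝ)
    (f := fun z' ↦ extChartAt (𝓡 4) (Φ (z + c)) (Φ z')) (x := z) c
  have h2 : ∀ i : Fin 4, fderiv ℝ (fun z' ↦ fderiv ℝ (fun z' ↦
      extChartAt (𝓡 4) (Φ (z + c)) (Φ (z' + c))) z' w i) z =
      fderiv ℝ (fun z' ↦ fderiv ℝ (fun z' ↦ extChartAt (𝓡 4) (Φ (z + c)) (Φ z')) z' w i)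
        (z + c) := by
    intro i
    rw [← fderiv_comp_add_right]
    congr 1
    ext z'
    rw [← fderiv_comp_add_right]
  simp only [h2, h1]
  rfl

lemma sectionMetric_comp_add_right (g : LorentzMetric M) {Φ : Param → M} {z c : Param}
    (h : MDifferentiableAt 𝓘(ℝ, Param) (𝓡 4) Φ (z + c)) :
    sectionMetric g (fun z ↦ Φ (z + c)) z = sectionMetric g Φ (z + c) := by
  ext A B
  exact congrArg₂ (fun u v ↦ g.val (Φ (z + c)) u v) (mfderiv_comp_add_right h (dirX A))
    (mfderiv_comp_add_right h (dirX B))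

lemma expansion_comp_add_right (g : LorentzMetric M) {Φ : Param → M} {z c : Param}
    (h : MDifferentiableAt 𝓘(ℝ, Param) (𝓡 4) Φ (z + c)) :
    expansion g (fun z ↦ Φ (z + c)) z = expansion g Φ (z + c) := by
  simp only [expansion, sectionMetric_comp_add_right g h]
  refine Finset.sum_congr rfl fun A _ ↦ Finset.sum_congr rfl fun B _ ↦ ?_
  congr 1
  exact congrArg₂ (fun u v ↦ g.val (Φ (z + c)) u v)
    (covDerivAlong_comp_add_right g Φ z c (dirX A) dirL) (mfderiv_comp_add_right h (dirX B))

namespace LightSheet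
variable {g : LorentzMetric M}

lemma mdifferentiableAt (L : LightSheet g) {z : Param} (hz : z ∈ L.params) :
    MDifferentiableAt 𝓘(ℝ, Param) (𝓡 4) L.Φ z := by
  obtain ⟨W, hW, hsub, hΦ⟩ := L.smooth
  exact (hΦ.contMDiffAt (hW.mem_nhds (hsub hz))).mdifferentiableAt (by simp)

/-- Near every point of a light sheet there are points in the interior of the parameter set. -/
lemma exists_interior_of_isOpen (L : LightSheet g) {O : Set Param} (hO : IsOpen O) {z : Param}
    (hz : z ∈ L.params) (hzO : z ∈ O) :
    ∃ x l, (x, l) ∈ O ∧ x ∈ interior L.D ∧ 0 < l ∧ l < L.endpoint x := by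
  obtain ⟨x₀, l₀⟩ := z
  -- A small slide toward the midpoint of the generator leaves both ends, even if `z` lies on `B` or
  -- `B'`.
  obtain ⟨l, hl0, hle, hlO⟩ : ∃ l, 0 < l ∧ l < L.endpoint x₀ ∧ (x₀, l) ∈ O := by
    have hc : Continuous fun t : ℝ ↦
        ((x₀, l₀ + t * (L.endpoint x₀ / 2 - l₀)) : Param) := by fun_prop
    have h1 : ∀ᶠ t in 𝓝[>] (0 : ℝ), (x₀, l₀ + t * (L.endpoint x₀ / 2 - l₀)) ∈ O :=
      (hc.continuousAt.eventually (hO.mem_nhds (by simpa using hzO))).filter_mono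
        nhdsWithin_le_nhds
    have h2 : ∀ᶠ t in 𝓝[>] (0 : ℝ), t ∈ Set.Ioo (0 : ℝ) 1 := Ioo_mem_nhdsGT one_pos
    obtain ⟨t, ht, ht0, ht1⟩ := (h1.and h2).exists
    have h3 : 0 ≤ l₀ := hz.2.1
    have h4 : l₀ ≤ L.endpoint x₀ := hz.2.2
    have h5 := L.endpoint_pos x₀ hz.1
    refine ⟨_, ?_, ?_, ht⟩ <;> nlinarith
  -- With `l` fixed, `x₀` is then moved into the interior of `D`, close enough to keep `l` below the
  -- endpoint.
  obtain ⟨x, hx, hxD⟩ := mem_closure_iff_nhds.1 (L.subset_closure_interior hz.1) _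
    (((L.differentiableAt_endpoint hz.1).continuousAt.eventually (lt_mem_nhds hle)).and
      ((show Continuous fun x : Fin 2 → ℝ ↦ ((x, l) : Param) by fun_prop).continuousAt.eventually
        (hO.mem_nhds hlO)))
  exact ⟨x, l, hx.2, hxD, hl0, hx.1⟩

/-- A coordinate vector of a cross-section vanishes only in the zero direction. -/
lemma eq_zero_of_mfderiv_eq_zero (L : LightSheet g) {z : Param} (hz : z ∈ L.params)
    {v : Fin 2 → ℝ} (hv : mfderiv 𝓘(ℝ, Param) (𝓡 4) L.Φ z (v, 0) = 0) : v = 0 := by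
  have hpos := L.spacelike z hz.1 hz.2.1 hz.2.2
  let T : Param →L[ℝ] E4 := mfderiv 𝓘(ℝ, Param) (𝓡 4) L.Φ z
  have h1 : ((v, 0) : Param) = v 0 • dirX 0 + v 1 • dirX 1 := by
    ext i
    · fin_cases i <;> simp [dirX]
    · simp [dirX]
  have h2 : v 0 • tangentX L.Φ 0 z + v 1 • tangentX L.Φ 1 z = 0 := by
    have h3 : T (v, 0) = 0 := hv
    rw [h1, map_add, map_smul, map_smul] at h3
    exact h3
  have h4 : ∀ B, v 0 * sectionMetric g L.Φ z 0 B + v 1 * sectionMetric g L.Φ z 1 B = 0 := by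
    intro B
    have h5 := congrArg (fun u ↦ g.val (L.Φ z) u (tangentX L.Φ B z)) h2
    simp only [map_add, map_smul, add_apply, smul_apply, smul_eq_mul, map_zero, zero_apply]
      at h5
    exact h5
  by_contra hne
  refine hne (Matrix.eq_zero_of_vecMul_eq_zero hpos.det_pos.ne' ?_)
  ext B
  simpa [Matrix.vecMul, dotProduct, Fin.sum_univ_two] using h4 B

/-- The cross-sections of a light sheet are locally embedded. -/
lemma exists_isOpen_injOn (L : LightSheet g) {x : Fin 2 → ℝ} {l : ℝ} (hz : (x, l) ∈ L.params) :
    ∃ O : Set (Fin 2 → ℝ), IsOpen O ∧ x ∈ O ∧ Set.InjOn (fun x ↦ L.Φ (x, l)) O := by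
  obtain ⟨W, hW, hsub, hΦ⟩ := L.smooth
  have hq := mem_extChartAt_source (I := 𝓡 4) (L.Φ (x, l))
  have h1 := (contDiffAt_chart_comp hW hΦ (hsub hz) hq).hasStrictFDerivAt (by simp)
  have h2 : HasStrictFDerivAt (fun x : Fin 2 → ℝ ↦ ((x, l) : Param))
      (ContinuousLinearMap.inl ℝ (Fin 2 → ℝ) ℝ) x :=
    (hasStrictFDerivAt_id x).prodMk (hasStrictFDerivAt_const l x)
  obtain ⟨O, hO, hxO, hinj⟩ := exists_isOpen_injOn_of_hasStrictFDerivAt (h1.comp x h2) (by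
    rw [injective_iff_map_eq_zero]
    intro v hv
    refine L.eq_zero_of_mfderiv_eq_zero hz ((comp (L.Φ (x, l))).injective ?_)
    rw [comp_mfderiv hW hΦ (hsub hz), map_zero]
    exact hv)
  exact ⟨O, hO, hxO, fun a ha b hb hab ↦ hinj ha hb (congrArg _ hab)⟩

/-- The part of a light sheet above a ball of generators and between two constant values of the
affine parameter. -/
def restrict (L : LightSheet g) (x₁ : Fin 2 → ℝ) (l₁ r ε : ℝ) (hr : 0 < r) (hε : 0 < ε)
    (hsub : ∀ z : Param, z.1 ∈ Metric.closedBall x₁ r ∧ 0 ≤ z.2 ∧ z.2 ≤ ε →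
      z + (0, l₁) ∈ L.params)
    (hinj : Set.InjOn (fun x ↦ L.Φ (x, l₁)) (Metric.closedBall x₁ r)) : LightSheet g where
  D := Metric.closedBall x₁ r
  isCompact := isCompact_closedBall x₁ r
  subset_closure_interior := by
    rw [interior_closedBall x₁ hr.ne', closure_ball x₁ hr.ne']
  endpoint := fun _ ↦ ε
  endpoint_pos := fun _ _ ↦ hε
  endpoint_smooth := ⟨Set.univ, isOpen_univ, Set.subset_univ _, contDiffOn_const⟩
  Φ := fun z ↦ L.Φ (z + (0, l₁))
  smooth := by
    obtain ⟨W, hW, hW', hΦ⟩ := L.smooth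
    refine ⟨(fun z ↦ z + (0, l₁)) ⁻¹' W, hW.preimage (by fun_prop), fun z hz ↦ hW' (hsub z hz), ?_⟩
    · refine hΦ.comp ?_ (fun z hz ↦ hz)
      exact (contDiff_id.add contDiff_const).contMDiff.contMDiffOn
  injective := ⟨∅, by simp, fun a ha b hb hab ↦ hinj ha.1 hb.1 (by simpa using hab)⟩
  spacelike := fun z hx h0 h1 ↦ by
    have hz := hsub z ⟨hx, h0, h1⟩
    rw [sectionMetric_comp_add_right g (L.mdifferentiableAt hz)]
    exact L.spacelike _ hz.1 hz.2.1 hz.2.2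
  ne_zero := fun z hx h0 h1 ↦ by
    have hz := hsub z ⟨hx, h0, h1⟩
    rw [generator, mfderiv_comp_add_right (L.mdifferentiableAt hz)]
    exact L.ne_zero _ hz.1 hz.2.1 hz.2.2
  null := fun z hx h0 h1 ↦ by
    have hz := hsub z ⟨hx, h0, h1⟩
    rw [generator, mfderiv_comp_add_right (L.mdifferentiableAt hz)]
    exact L.null _ hz.1 hz.2.1 hz.2.2
  normal := fun z hx h0 h1 A ↦ by
    have hz := hsub z ⟨hx, h0, h1⟩
    rw [generator, tangentX, mfderiv_comp_add_right (L.mdifferentiableAt hz),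
      mfderiv_comp_add_right (L.mdifferentiableAt hz)]
    exact L.normal _ hz.1 hz.2.1 hz.2.2 A
  geodesic := fun z hx h0 h1 ↦ by
    have hz := hsub z ⟨hx, h0, h1⟩
    rw [covDerivAlong_comp_add_right]
    exact L.geodesic _ hz.1 hz.2.1 hz.2.2
  expansion_nonpos := fun z hx h0 h1 ↦ by
    have hz := hsub z ⟨hx, h0, h1⟩
    rw [expansion_comp_add_right g (L.mdifferentiableAt hz)]
    exact L.expansion_nonpos _ hz.1 hz.2.1 hz.2.2

/-- If the pointwise condition fails at a point of a light sheet, then the entropy bound fails for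
a small part of the light sheet. -/
lemma exists_not_entropyBoundHolds (L : LightSheet g) {S : ∀ p : M, TangentSpace (𝓡 4) p}
    {U : Set M} (hU : IsOpen U)
    (hS : ContinuousOn (fun p ↦ (⟨p, S p⟩ : TangentBundle (𝓡 4) M)) U) {z : Param}
    (hz : z ∈ L.params) (hzU : L.Φ z ∈ U) (hpos : 0 < L.surplus S z) :
    ∃ L' : LightSheet g, L'.carrier ⊆ U ∧
      (∀ N : Set (TangentBundle (𝓡 4) M), L.TangentIn N → L'.TangentIn N) ∧
      ¬ L'.EntropyBoundHolds S := by
  obtain ⟨O, hO, hzO, hOp⟩ : ∃ O : Set Param, IsOpen O ∧ z ∈ O ∧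
      ∀ z' ∈ O ∩ L.params, L.Φ z' ∈ U ∧ 0 < L.surplus S z' := by
    obtain ⟨W, hW, hsub, hΦ⟩ := L.smooth
    have h1 : L.Φ ⁻¹' U ∈ 𝓝[L.params] z :=
      ((hΦ.continuousOn.mono hsub) z hz).eventually (hU.mem_nhds hzU)
    have h2 : ∀ᶠ z' in 𝓝[L.params ∩ L.Φ ⁻¹' U] z, 0 < L.surplus S z' :=
      (L.continuousOn_surplus hS z ⟨hz, hzU⟩).eventually (lt_mem_nhds hpos)
    -- Since `U` is open, restricting to its preimage does not change neighbourhoods within the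
    -- sheet. The original sheet may leave `U`.
    rw [Set.inter_comm, nhdsWithin_inter_of_mem h1] at h2
    obtain ⟨O, hO, hzO, h⟩ := mem_nhdsWithin.1 (Filter.inter_mem h1 h2)
    exact ⟨O, hO, hzO, h⟩
  obtain ⟨x₁, l₁, hx₁O, hx₁D, hl₁0, hx₁e⟩ := L.exists_interior_of_isOpen hO hz hzO
  have hx₁p : (x₁, l₁) ∈ L.params := ⟨interior_subset hx₁D, hl₁0.le, hx₁e.le⟩
  -- A light sheet is one-to-one only on its initial surface `λ = 0`; the new piece starts at `l₁`,
  -- where injectivity comes from the immersion.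
  obtain ⟨O', hO', hx₁O', hinj⟩ := L.exists_isOpen_injOn hx₁p
  have hev : ∀ᶠ z in 𝓝 ((x₁, l₁) : Param), z ∈ O ∧ z.1 ∈ interior L.D ∩ O' ∧
      z.2 < L.endpoint z.1 := by
    have h1 : ContinuousAt (fun z : Param ↦ L.endpoint z.1) (x₁, l₁) :=
      (L.differentiableAt_endpoint (interior_subset hx₁D)).continuousAt.comp
        (f := fun z : Param ↦ z.1) continuousAt_fst
    have h2 : ∀ᶠ z in 𝓝 ((x₁, l₁) : Param), z ∈ O := hO.mem_nhds hx₁O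
    exact h2.and ((continuousAt_fst.eventually
      ((isOpen_interior.inter hO').mem_nhds ⟨hx₁D, hx₁O'⟩)).and
        (continuousAt_snd.eventually_lt h1 hx₁e))
  -- In the max metric a closed ball is a product, so one `r` serves as radius of the ball of
  -- generators and as length in `λ`.
  obtain ⟨r, hr, hball⟩ := Metric.nhds_basis_closedBall.eventually_iff.1 hev
  have hmem : ∀ z : Param, z.1 ∈ Metric.closedBall x₁ r ∧ 0 ≤ z.2 ∧ z.2 ≤ r →
      z + (0, l₁) ∈ O ∧ (z + (0, l₁)).1 ∈ interior L.D ∩ O' ∧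
        (z + (0, l₁)).2 < L.endpoint (z + (0, l₁)).1 := by
    rintro ⟨x, l⟩ ⟨hx, h0, h1⟩
    refine hball ?_
    rw [← closedBall_prod_same]
    refine ⟨by simpa using hx, ?_⟩
    have h0' : 0 ≤ l := h0
    simpa [Real.dist_eq, abs_of_nonneg h0'] using h1
  have hsub : ∀ z : Param, z.1 ∈ Metric.closedBall x₁ r ∧ 0 ≤ z.2 ∧ z.2 ≤ r →
      z + (0, l₁) ∈ L.params := fun z hz' ↦
    ⟨interior_subset (hmem z hz').2.1.1, add_nonneg hz'.2.1 hl₁0.le, (hmem z hz').2.2.le⟩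
  have hinj' : Set.InjOn (fun x ↦ L.Φ (x, l₁)) (Metric.closedBall x₁ r) :=
    hinj.mono fun x hx ↦ by simpa using (hmem (x, 0) ⟨hx, le_rfl, hr.le⟩).2.1.2
  have hgen : ∀ z ∈ (L.restrict x₁ l₁ r r hr hr hsub hinj').params,
      generator (L.restrict x₁ l₁ r r hr hr hsub hinj').Φ z = generator L.Φ (z + (0, l₁)) :=
    fun z hz' ↦ mfderiv_comp_add_right (L.mdifferentiableAt (hsub z hz')) dirL
  have hcar : (L.restrict x₁ l₁ r r hr hr hsub hinj').carrier ⊆ U := by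
    rintro p ⟨z, hz', rfl⟩
    exact (hOp _ ⟨(hmem z hz').1, hsub z hz'⟩).1
  refine ⟨L.restrict x₁ l₁ r r hr hr hsub hinj', hcar, fun N hN z hz' ↦ ?_,
    not_entropyBoundHolds_of_surplus_pos _ hS hcar ?_ fun z hz' ↦ ?_⟩
  · rw [hgen z hz']
    exact hN _ (hsub z hz')
  · exact (Metric.measure_closedBall_pos _ x₁ hr).ne'
  · have h := (hOp _ ⟨(hmem z hz').1, hsub z hz'⟩).2
    simp only [surplus, flux] at h ⊢
    rw [hgen z hz']
    have he : expansion g (L.restrict x₁ l₁ r r hr hr hsub hinj').Φ z =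
        expansion g L.Φ (z + (0, l₁)) :=
      expansion_comp_add_right g (L.mdifferentiableAt (hsub z hz'))
    rw [he]
    exact h

lemma surplus_nonpos_iff (L : LightSheet g) (S : ∀ p : M, TangentSpace (𝓡 4) p) (z : Param) :
    L.surplus S z ≤ 0 ↔ L.flux S z ≤ -(1 / 4) * expansion g L.Φ z := by
  rw [surplus]
  constructor <;> intro h <;> linarith

end LightSheet

/-- The entropy bound for the light sheets in `U` with tangents in `N` is equivalent to the
pointwise condition on `U`. -/
theorem forall_entropyBoundHolds_iff {g : LorentzMetric M} {U : Set M} (hU : IsOpen U)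
    {S : ∀ p : M, TangentSpace (𝓡 4) p}
    (hS : ContinuousOn (fun p ↦ (⟨p, S p⟩ : TangentBundle (𝓡 4) M)) U)
    (N : Set (TangentBundle (𝓡 4) M)) :
    (∀ L : LightSheet g, L.carrier ⊆ U → L.TangentIn N → L.EntropyBoundHolds S) ↔
      ∀ p ∈ U, ConditionA g S N p := by
  constructor
  · rintro h p hp L hL z hz rfl
    rw [← L.surplus_nonpos_iff]
    by_contra! hpos
    obtain ⟨L', hL'U, hL'N, hL'⟩ := L.exists_not_entropyBoundHolds hU hS hz hp hpos
    exact hL' (h L' hL'U (hL'N N hL))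
  · intro h L hLU hL
    refine L.entropyBoundHolds_of_surplus_nonpos hS hLU fun z hz ↦ ?_
    rw [L.surplus_nonpos_iff]
    exact h _ (hLU ⟨z, hz, rfl⟩) L hL z hz rfl
end
end EntropyBound

/-! ### The expansion of a sheet generated by a field is the divergence of the field. -/

namespace EntropyBound

/-- The trace of an endomorphism that annihilates a null vector `k` and maps into its orthogonal
complement is the trace over a spacelike pair of vectors orthogonal to `k`. -/
lemma trace_eq_sum_inv_gram (G : E4 →L[ℝ] E4 →L[ℝ] ℝ) (hG : ∀ v w, G v w = G w v)
    (T : E4 →ₗ[ℝ] E4) {k l : E4} {e : Fin 2 → E4} (hkk : G k k = 0) (hke : ∀ A, G k (e A) = 0)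
    (hkl : G k l ≠ 0) (hTk : T k = 0) (hkT : ∀ v, G k (T v) = 0)
    (hdet : (Matrix.of fun A B ↦ G (e A) (e B)).det ≠ 0) :
    LinearMap.trace ℝ E4 T =
      ∑ A, ∑ B, (Matrix.of fun A B ↦ G (e A) (e B))⁻¹ A B * G (T (e A)) (e B) := by
  have hek : ∀ A, G (e A) k = 0 := fun A ↦ (hG _ _).trans (hke A)
  have h10 := hG (e 1) (e 0)
  rw [Matrix.det_fin_two] at hdet
  simp only [Matrix.of_apply, h10] at hdet
  -- Pairing with `k` isolates the coefficient of `l`; pairing with `e 0` and `e 1` then gives a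
  -- system with the invertible Gram matrix.
  have hli : LinearIndependent ℝ ![k, e 0, e 1, l] := by
    rw [Fintype.linearIndependent_iff]
    intro c hc
    simp only [Fin.sum_univ_four, Matrix.cons_val] at hc
    have h3 : c 3 = 0 := by
      have h := congrArg (G k) hc
      simp only [map_add, map_smul, hkk, hke, smul_eq_mul, mul_zero, zero_add, map_zero,
        mul_eq_zero, hkl, or_false] at h
      exact h
    have h0 := congrArg (G (e 0)) hc
    have h1 := congrArg (G (e 1)) hc
    simp only [map_add, map_smul, hek, h3, smul_eq_mul, mul_zero, zero_add, map_zero, zero_mul,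
      add_zero, h10] at h0 h1
    have hc1 : c 1 = 0 := by
      refine (mul_eq_zero.1 ?_).resolve_right hdet
      linear_combination G (e 1) (e 1) * h0 - G (e 0) (e 1) * h1
    have hc2 : c 2 = 0 := by
      refine (mul_eq_zero.1 ?_).resolve_right hdet
      linear_combination G (e 0) (e 0) * h1 - G (e 0) (e 1) * h0
    have hk : k ≠ 0 := by
      rintro rfl
      simp at hkl
    have hc0 : c 0 = 0 := by
      simpa [hc1, hc2, h3, hk] using hc
    intro i
    fin_cases i <;> assumption
  let b := basisOfLinearIndependentOfCardEqFinrank hli (by simp)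
  have hb : ∀ i, b i = ![k, e 0, e 1, l] i := fun i ↦ by simp [b]
  have hrepr : ∀ v, v = b.repr v 0 • k + b.repr v 1 • e 0 + b.repr v 2 • e 1 +
      b.repr v 3 • l := by
    intro v
    conv_lhs => rw [← b.sum_repr v]
    simp only [Fin.sum_univ_four, hb, Matrix.cons_val]
  -- Only `l` pairs nontrivially with `k`, so a vector orthogonal to `k` has no `l` component.
  have h3 : ∀ v, b.repr (T v) 3 = 0 := by
    intro v
    have h := hkT v
    rw [hrepr (T v)] at h
    simp only [map_add, map_smul, hkk, hke, smul_eq_mul, mul_zero, zero_add,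
      mul_eq_zero, hkl, or_false] at h
    exact h
  have hT : ∀ A B, G (T (e A)) (e B) =
      b.repr (T (e A)) 1 * G (e 0) (e B) + b.repr (T (e A)) 2 * G (e 1) (e B) := by
    intro A B
    conv_lhs => rw [hrepr (T (e A)), h3]
    simp only [map_add, map_smul, add_apply, smul_apply, hke, smul_eq_mul, mul_zero, zero_add,
      zero_smul, add_zero]
  -- The diagonal entry at `k` vanishes by `T k = 0`, the one at `l` by `h3`.
  have htr : LinearMap.trace ℝ E4 T = b.repr (T (e 0)) 1 + b.repr (T (e 1)) 2 := by
    rw [LinearMap.trace_eq_matrix_trace ℝ b, Matrix.trace]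
    simp only [Matrix.diag_apply, LinearMap.toMatrix_apply, Fin.sum_univ_four, hb,
      Matrix.cons_val, hTk, h3, map_zero]
    simp
  rw [htr, Matrix.inv_def, Matrix.adjugate_fin_two, Ring.inverse_eq_inv', Matrix.det_fin_two]
  simp only [Fin.sum_univ_two, Matrix.smul_apply, smul_eq_mul, Matrix.of_apply,
    Matrix.cons_val', Matrix.cons_val_zero, Matrix.cons_val_one, Matrix.cons_val_fin_one, hT, h10]
  linear_combination -(b.repr (T (e 0)) 1 + b.repr (T (e 1)) 2) * inv_mul_cancel₀ hdet

/-- Two `C¹` maps that agree on a set have the same derivative at every point of the closure of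
the interior of the set. -/
lemma fderiv_eq_of_eqOn_of_mem_closure_interior {E F : Type*} [NormedAddCommGroup E]
    [NormedSpace ℝ E] [NormedAddCommGroup F] [NormedSpace ℝ F] {f h : E → F} {P : Set E} {z : E}
    (hf : ContDiffAt ℝ 1 f z) (hh : ContDiffAt ℝ 1 h z) (heq : Set.EqOn f h P)
    (hz : z ∈ closure (interior P)) : fderiv ℝ f z = fderiv ℝ h z := by
  have hne : (𝓝[interior P] z).NeBot := mem_closure_iff_nhdsWithin_neBot.1 hz
  have h1 : Filter.Tendsto (fderiv ℝ f) (𝓝[interior P] z) (𝓝 (fderiv ℝ f z)) :=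
    (hf.continuousAt_fderiv (by simp)).tendsto.mono_left nhdsWithin_le_nhds
  have h2 : Filter.Tendsto (fderiv ℝ h) (𝓝[interior P] z) (𝓝 (fderiv ℝ h z)) :=
    (hh.continuousAt_fderiv (by simp)).tendsto.mono_left nhdsWithin_le_nhds
  -- The derivatives agree on the open interior, and their continuity carries the equality to its
  -- closure.
  refine tendsto_nhds_unique (h1.congr' ?_) h2
  filter_upwards [self_mem_nhdsWithin] with y hy
  refine Filter.EventuallyEq.fderiv_eq ?_
  filter_upwards [isOpen_interior.mem_nhds hy] with y' hy'
  exact heq (interior_subset hy')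

section
variable {M : Type*} [TopologicalSpace M] [ChartedSpace E4 M] [IsManifold (𝓡 4) ∞ M]

/-- This links smoothness of a section, defined by bundle trivializations, to smoothness of its
chart components. -/
lemma trivializationAt_snd {q p : M} (hp : p ∈ (extChartAt (𝓡 4) q).source)
    (v : TangentSpace (𝓡 4) p) :
    (trivializationAt E4 (TangentSpace (𝓡 4)) q ⟨p, v⟩).2 = chartVec q p v := by
  have : IsManifold (𝓡 4) 1 M := .of_le (n := ∞) (by simp)
  have hp' : p ∈ (chartAt E4 q).source := by simpa using hp
  rw [chartVec, ← TangentBundle.continuousLinearMapAt_trivializationAt hp']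
  rw [Bundle.Trivialization.continuousLinearMapAt_apply,
    Bundle.Trivialization.coe_linearMapAt_of_mem _ (by simpa using hp')]

/-- The components of a `C¹` vector field are `C¹`. -/
lemma contDiffAt_chartVec {U : Set M} (hU : IsOpen U) {K : ∀ p : M, TangentSpace (𝓡 4) p}
    (hK : ContMDiffOn (𝓡 4) (𝓡 4).tangent 1 (fun p ↦ (⟨p, K p⟩ : TangentBundle (𝓡 4) M)) U)
    {q : M} (hq : q ∈ U) :
    ContDiffAt ℝ 1 (fun y ↦ chartVec q ((extChartAt (𝓡 4) q).symm y)
      (K ((extChartAt (𝓡 4) q).symm y))) (extChartAt (𝓡 4) q q) := by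
  have : IsManifold (𝓡 4) 1 M := .of_le (n := ∞) (by simp)
  have hsymm : ContMDiffAt 𝓘(ℝ, E4) (𝓡 4) 1 (extChartAt (𝓡 4) q).symm (extChartAt (𝓡 4) q q) :=
    (contMDiffOn_extChartAt_symm q).contMDiffAt (extChartAt_target_mem_nhds q)
  have hK' := hK.contMDiffAt (hU.mem_nhds hq)
  rw [Bundle.contMDiffAt_section] at hK'
  have hqq := extChartAt_to_inv (I := 𝓡 4) q
  have h := ContMDiffAt.comp_of_eq hK' hsymm hqq
  refine (h.contDiffAt).congr_of_eventuallyEq ?_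
  filter_upwards [extChartAt_target_mem_nhds (I := 𝓡 4) q] with y hy
  exact (trivializationAt_snd ((extChartAt (𝓡 4) q).map_target hy) _).symm

namespace LorentzMetric
variable (g : LorentzMetric M)

/-- The covariant derivative of a vector field at the point `q`, in components. -/
noncomputable def covDeriv (K : ∀ p : M, TangentSpace (𝓡 4) p) (q : M) : E4 →ₗ[ℝ] E4 where
  toFun v := WithLp.toLp 2 fun i ↦
    fderiv ℝ (fun y ↦ chartVec q ((extChartAt (𝓡 4) q).symm y)
      (K ((extChartAt (𝓡 4) q).symm y)) i) (extChartAt (𝓡 4) q q) v +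
    g.connection q (extChartAt (𝓡 4) q q) v (comp q (K q)) i
  map_add' v w := by
    ext i
    simp only [connection, map_add, PiLp.add_apply, mul_add, add_mul, Finset.sum_add_distrib]
    ring
  map_smul' c v := by
    ext i
    simp only [connection, map_smul, PiLp.smul_apply, smul_eq_mul, RingHom.id_apply, mul_add,
      Finset.mul_sum]
    congr 1
    exact Finset.sum_congr rfl fun j _ ↦ Finset.sum_congr rfl fun l _ ↦ by ring

/-- As a trace, the divergence can be evaluated in a basis adapted to the light sheet instead of the
coordinate basis. -/
lemma divergence_eq_trace (K : ∀ p : M, TangentSpace (𝓡 4) p) (q : M) :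
    g.divergence K q = LinearMap.trace ℝ E4 (g.covDeriv K q) := by
  have hKq : chartVec q ((extChartAt (𝓡 4) q).symm (extChartAt (𝓡 4) q q))
      (K ((extChartAt (𝓡 4) q).symm (extChartAt (𝓡 4) q q))) = comp q (K q) := by
    rw [extChartAt_to_inv, chartVec_self]
  have h1 : g.divergence K q = ∑ i, fderiv ℝ (fun y ↦ chartVec q ((extChartAt (𝓡 4) q).symm y)
      (K ((extChartAt (𝓡 4) q).symm y)) i) (extChartAt (𝓡 4) q q)
        (EuclideanSpace.single i (1 : ℝ)) +
      ∑ i, ∑ j, g.christoffel q (extChartAt (𝓡 4) q q) i i j *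
        chartVec q ((extChartAt (𝓡 4) q).symm (extChartAt (𝓡 4) q q))
          (K ((extChartAt (𝓡 4) q).symm (extChartAt (𝓡 4) q q))) j := rfl
  rw [h1, hKq, LinearMap.trace_eq_matrix_trace ℝ (EuclideanSpace.basisFun (Fin 4) ℝ).toBasis,
    Matrix.trace, ← Finset.sum_add_distrib]
  refine Finset.sum_congr rfl fun i _ ↦ ?_
  simp only [Matrix.diag_apply, LinearMap.toMatrix_apply, OrthonormalBasis.coe_toBasis,
    EuclideanSpace.basisFun_apply, OrthonormalBasis.coe_toBasis_repr_apply,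
    EuclideanSpace.basisFun_repr, covDeriv, LinearMap.coe_mk, AddHom.coe_mk, connection]
  congr 1
  symm
  rw [Finset.sum_eq_single i]
  · simp
  · intro j _ hj
    simp [hj]
  · simp

/-- The covariant derivative of a null vector field is orthogonal to the field. -/
lemma val_covDeriv_eq_zero {U : Set M} (hU : IsOpen U) {K : ∀ p : M, TangentSpace (𝓡 4) p}
    (hK : ContMDiffOn (𝓡 4) (𝓡 4).tangent 1 (fun p ↦ (⟨p, K p⟩ : TangentBundle (𝓡 4) M)) U)
    (hnull : ∀ p ∈ U, g.val p (K p) (K p) = 0) {q : M} (hq : q ∈ U) (v : E4) :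
    g.val q (K q) ((comp q).symm (g.covDeriv K q v)) = 0 := by
  set y₀ := extChartAt (𝓡 4) q q with hy₀
  set Kc : E4 → E4 := fun y ↦ chartVec q ((extChartAt (𝓡 4) q).symm y)
    (K ((extChartAt (𝓡 4) q).symm y)) with hKc
  have hKq : Kc y₀ = comp q (K q) := by
    simp only [hKc, hy₀]
    rw [extChartAt_to_inv, chartVec_self]
  have hd : ∀ i, DifferentiableAt ℝ (fun y ↦ Kc y i) y₀ := fun i ↦
    (EuclideanSpace.proj (𝕜 := ℝ) i).differentiableAt.comp y₀
      ((contDiffAt_chartVec hU hK hq).differentiableAt (by simp))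
  -- `g(K, K)` vanishes on a whole neighbourhood, so its derivative `2 g(K, ∇_v K)` vanishes at `q`.
  have hev : (fun y ↦ ∑ i, ∑ j, g.coeff q y i j * Kc y i * Kc y j) =ᶠ[𝓝 y₀] fun _ ↦ 0 := by
    have h1 : ∀ᶠ y in 𝓝 y₀, (extChartAt (𝓡 4) q).symm y ∈ U :=
      (continuousAt_extChartAt_symm q).eventually
        (hU.mem_nhds (by rw [extChartAt_to_inv]; exact hq))
    filter_upwards [extChartAt_target_mem_nhds (I := 𝓡 4) q, h1] with y hy hyU
    have h2 := g.val_eq_sum_coeff ((extChartAt (𝓡 4) q).map_target hy)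
      (K ((extChartAt (𝓡 4) q).symm y)) (K ((extChartAt (𝓡 4) q).symm y))
    rw [hnull _ hyU, (extChartAt (𝓡 4) q).right_inv hy] at h2
    exact h2.symm
  have h := g.fderiv_sum_coeff (ψ := fun y ↦ y) (a := Kc) (b := Kc) (z := y₀)
    (g.isUnit_det_coeff_self q)
    (fun i j ↦ g.differentiableAt_coeff q i j (mem_extChartAt_target q)) differentiableAt_fun_id
    hd hd v
  rw [hev.fderiv_eq] at h
  simp only [fderiv_fun_const, Pi.zero_apply, zero_apply, fderiv_fun_id,
    ContinuousLinearMap.id_apply, hKq] at h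
  have h3 : g.val q (K q) ((comp q).symm (g.covDeriv K q v)) =
      ∑ i, ∑ j, g.coeff q y₀ i j * comp q (K q) i *
        (fderiv ℝ (fun y ↦ Kc y j) y₀ v + g.connection q y₀ v (comp q (K q)) j) := by
    rw [g.val_eq_sum_coeff_self, ContinuousLinearEquiv.apply_symm_apply]
    rfl
  have h4 : g.val q ((comp q).symm (g.covDeriv K q v)) (K q) =
      ∑ i, ∑ j, g.coeff q y₀ i j *
        (fderiv ℝ (fun y ↦ Kc y i) y₀ v + g.connection q y₀ v (comp q (K q)) i) *
          comp q (K q) j := by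
    rw [g.val_eq_sum_coeff_self, ContinuousLinearEquiv.apply_symm_apply]
    rfl
  rw [← h3, ← h4, g.symm q _ (K q)] at h
  linarith

end LorentzMetric

namespace LightSheet
variable {g : LorentzMetric M}

/-- This makes `k = K`, known only on the sheet, determine parameter derivatives in all directions,
boundary points included. -/
lemma params_subset_closure_interior (L : LightSheet g) :
    L.params ⊆ closure (interior L.params) := by
  intro z hz
  rw [mem_closure_iff]
  intro O hO hzO
  obtain ⟨x, l, hO', hx, h0, h1⟩ := L.exists_interior_of_isOpen hO hz hzO
  refine ⟨(x, l), hO', mem_interior_iff_mem_nhds.2 ?_⟩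
  have h2 : ContinuousAt (fun z : Param ↦ L.endpoint z.1) (x, l) :=
    (L.differentiableAt_endpoint (interior_subset hx)).continuousAt.comp
      (f := fun z : Param ↦ z.1) continuousAt_fst
  filter_upwards [continuousAt_fst.eventually (isOpen_interior.mem_nhds hx),
    continuousAt_snd.eventually (lt_mem_nhds h0), continuousAt_snd.eventually_lt h2 h1]
    with z' hx' h0' h1'
  exact ⟨interior_subset hx', h0'.le, h1'.le⟩

/-- Along a light sheet generated by `K`, the covariant derivative of the tangent is that
of `K`. -/
lemma comp_covDerivAlong_dirL {L : LightSheet g} {U : Set M} (hU : IsOpen U)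
    {K : ∀ p : M, TangentSpace (𝓡 4) p}
    (hK : ContMDiffOn (𝓡 4) (𝓡 4).tangent 1 (fun p ↦ (⟨p, K p⟩ : TangentBundle (𝓡 4) M)) U)
    (hL : L.GeneratedBy K) {z : Param} (hz : z ∈ L.params) (hzU : L.Φ z ∈ U) (v : Param) :
    comp (L.Φ z) (g.covDerivAlong L.Φ z v dirL) =
      g.covDeriv K (L.Φ z) (comp (L.Φ z) (mfderiv 𝓘(ℝ, Param) (𝓡 4) L.Φ z v)) := by
  obtain ⟨W, hW, hsub, hΦ⟩ := L.smooth
  have hq := mem_extChartAt_source (I := 𝓡 4) (L.Φ z)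
  set q := L.Φ z with hqdef
  set ψ : Param → E4 := fun z' ↦ extChartAt (𝓡 4) q (L.Φ z') with hψ
  set Kc : E4 → E4 := fun y ↦ chartVec q ((extChartAt (𝓡 4) q).symm y)
    (K ((extChartAt (𝓡 4) q).symm y)) with hKc
  have hψz : ContDiffAt ℝ ∞ ψ z := contDiffAt_chart_comp hW hΦ (hsub hz) hq
  have hKcd : ContDiffAt ℝ 1 Kc (ψ z) := contDiffAt_chartVec hU hK hzU
  have hf : ContDiffAt ℝ 1 (fun z' ↦ fderiv ℝ ψ z' dirL) z :=
    (hψz.fderiv_right (m := 1) (WithTop.coe_le_coe.2 (le_top (a := (1 + 1 : ℕ∞))))).clm_apply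
      contDiffAt_const
  have hh : ContDiffAt ℝ 1 (fun z' ↦ Kc (ψ z')) z :=
    hKcd.comp z (hψz.of_le (by simp))
  have heq : Set.EqOn (fun z' ↦ fderiv ℝ ψ z' dirL) (fun z' ↦ Kc (ψ z'))
      (L.params ∩ (W ∩ L.Φ ⁻¹' (extChartAt (𝓡 4) q).source)) := by
    rintro z' ⟨hz', hzW, hzq⟩
    have h1 := chartVec_mfderiv hW hΦ hzW hzq dirL
    have h2 : mfderiv 𝓘(ℝ, Param) (𝓡 4) L.Φ z' dirL = K (L.Φ z') := hL z' hz'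
    simp only [hKc, hψ]
    rw [(extChartAt (𝓡 4) q).left_inv hzq, ← h1, h2]
  have hmem : z ∈ closure (interior
      (L.params ∩ (W ∩ L.Φ ⁻¹' (extChartAt (𝓡 4) q).source))) := by
    have ho := isOpen_inter_preimage_source hW hΦ q
    rw [interior_inter, ho.interior_eq]
    exact ho.closure_inter (s := interior L.params)
      ⟨L.params_subset_closure_interior hz, hsub hz, hq⟩
  -- Differentiating `∂_λ ψ = Kc ∘ ψ`, which holds on the parameter set only.
  have key := fderiv_eq_of_eqOn_of_mem_closure_interior hf hh heq hmem
  have hchain : fderiv ℝ (fun z' ↦ Kc (ψ z')) z v = fderiv ℝ Kc (ψ z) (fderiv ℝ ψ z v) :=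
    DFunLike.congr_fun (fderiv_comp z (hKcd.differentiableAt (by simp))
      (hψz.differentiableAt (by simp))) v
  have hcoord : ∀ {F : Type} [NormedAddCommGroup F] [NormedSpace ℝ F] {f : F → E4} {x : F}
      (_ : DifferentiableAt ℝ f x) (i : Fin 4) (u : F),
      fderiv ℝ (fun x ↦ f x i) x u = fderiv ℝ f x u i := by
    intro F _ _ f x hf i u
    exact DFunLike.congr_fun
      (((EuclideanSpace.proj (𝕜 := ℝ) i : E4 →L[ℝ] ℝ).hasFDerivAt.comp x hf.hasFDerivAt).fderiv) u
  ext i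
  have hk : fderiv ℝ ψ z dirL = comp q (K q) := by
    rw [← comp_mfderiv hW hΦ (hsub hz)]
    exact congrArg _ (hL z hz)
  rw [g.comp_covDerivAlong, comp_mfderiv hW hΦ (hsub hz)]
  change fderiv ℝ (fun z' ↦ fderiv ℝ ψ z' dirL i) z v +
    g.connection q (ψ z) (fderiv ℝ ψ z v) (fderiv ℝ ψ z dirL) i =
    fderiv ℝ (fun y ↦ Kc y i) (ψ z) (fderiv ℝ ψ z v) +
      g.connection q (ψ z) (fderiv ℝ ψ z v) (comp q (K q)) i
  rw [hcoord (hf.differentiableAt (by simp)), hcoord (hKcd.differentiableAt (by simp)), key,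
    hchain, hk]

/-- The expansion of a light sheet generated by a null vector field is the divergence of the
field. -/
lemma expansion_eq_divergence {L : LightSheet g} {U : Set M} (hU : IsOpen U)
    {K : ∀ p : M, TangentSpace (𝓡 4) p}
    (hK : ContMDiffOn (𝓡 4) (𝓡 4).tangent 1 (fun p ↦ (⟨p, K p⟩ : TangentBundle (𝓡 4) M)) U)
    (hnull : ∀ p ∈ U, g.val p (K p) (K p) = 0)
    (hL : L.GeneratedBy K) {z : Param} (hz : z ∈ L.params) (hzU : L.Φ z ∈ U) :
    expansion g L.Φ z = g.divergence K (L.Φ z) := by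
  have hcov := comp_covDerivAlong_dirL hU hK hL hz hzU
  set q := L.Φ z with hq
  have hkK : generator L.Φ z = K q := hL z hz
  let G : E4 →L[ℝ] E4 →L[ℝ] ℝ := g.val q
  -- The fourth basis vector, transverse to the sheet, exists because `k ≠ 0` and the metric is
  -- nondegenerate.
  obtain ⟨l, hl⟩ : ∃ l, G (comp q (K q)) l ≠ 0 := by
    by_contra! hcon
    refine L.ne_zero z hz.1 hz.2.1 hz.2.2 ?_
    rw [hkK]
    exact g.nondegenerate fun w ↦ hcon w
  -- The affine geodesic equation reads `∇_K K = 0`.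
  have hTk : g.covDeriv K q (comp q (K q)) = 0 := by
    have h := hcov dirL
    rw [L.geodesic z hz.1 hz.2.1 hz.2.2, map_zero] at h
    rw [← hkK]
    exact h.symm
  have hnormal : ∀ A, G (comp q (K q)) (comp q (tangentX L.Φ A z)) = 0 := by
    intro A
    have h := L.normal z hz.1 hz.2.1 hz.2.2 A
    rw [hkK] at h
    exact h
  have htr := trace_eq_sum_inv_gram G (g.symm q) (g.covDeriv K q) (k := comp q (K q)) (l := l)
    (e := fun A ↦ comp q (tangentX L.Φ A z)) (hnull q hzU) hnormal hl hTk
    (g.val_covDeriv_eq_zero hU hK hnull hzU)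
    (L.spacelike z hz.1 hz.2.1 hz.2.2).det_pos.ne'
  rw [g.divergence_eq_trace, htr]
  refine Finset.sum_congr rfl fun A _ ↦ Finset.sum_congr rfl fun B _ ↦ ?_
  have h := hcov (dirX A)
  rw [show (mfderiv 𝓘(ℝ, Param) (𝓡 4) L.Φ z (dirX A)) = tangentX L.Φ A z from rfl] at h
  rw [← h]
  rfl

end LightSheet
end
end EntropyBound

/-! ### The two equivalences. -/

theorem proposition1 {M : Type*} [TopologicalSpace M] [ChartedSpace EntropyBound.E4 M]
    [IsManifold (𝓡 4) ∞ M] (g : EntropyBound.LorentzMetric M)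
    (U : Set M) (hU : IsOpen U) (S : ∀ p : M, TangentSpace (𝓡 4) p)
    (hS : ContinuousOn (fun p ↦ (⟨p, S p⟩ : TangentBundle (𝓡 4) M)) U) :
    (∀ N : Set (TangentBundle (𝓡 4) M),
      (∀ L : EntropyBound.LightSheet g, L.carrier ⊆ U → L.TangentIn N → L.EntropyBoundHolds S) ↔
        ∀ p ∈ U, EntropyBound.ConditionA g S N p) ∧
    (∀ K : ∀ p : M, TangentSpace (𝓡 4) p,
      ContMDiffOn (𝓡 4) (𝓡 4).tangent 1 (fun p ↦ (⟨p, K p⟩ : TangentBundle (𝓡 4) M)) U →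
      (∀ p ∈ U, ∃ L : EntropyBound.LightSheet g,
        L.carrier ⊆ U ∧ L.GeneratedBy K ∧ p ∈ L.carrier) →
      ((∀ L : EntropyBound.LightSheet g, L.carrier ⊆ U → L.GeneratedBy K →
          L.EntropyBoundHolds S) ↔
        ∀ p ∈ U, - g.val p (K p) (S p) ≤ -(1 / 4) * g.divergence K p)) := by
  refine ⟨EntropyBound.forall_entropyBoundHolds_iff hU hS, fun K hK hcover ↦ ?_⟩
  -- The sheets cover `U`, so `K` is null on an open set and `g(K, K) = 0` may be differentiated in
  -- every direction.
  have hnull : ∀ p ∈ U, g.val p (K p) (K p) = 0 := by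
    intro p hp
    obtain ⟨L, -, hL, z, hz, rfl⟩ := hcover p hp
    rw [← hL z hz]
    exact L.null z hz.1 hz.2.1 hz.2.2
  -- For this set of tangents, `TangentIn` unfolds to `GeneratedBy K`.
  refine (EntropyBound.forall_entropyBoundHolds_iff hU hS {v | v.2 = K v.1}).trans ?_
  constructor
  · intro h p hp
    -- Condition (A) says something at `p` only if a sheet passes through `p`; the covering supplies
    -- one.
    obtain ⟨L, -, hL, z, hz, rfl⟩ := hcover p hp
    have h1 := h _ hp L hL z hz rfl
    rw [EntropyBound.LightSheet.expansion_eq_divergence hU hK hnull hL hz hp,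
      EntropyBound.LightSheet.flux, hL z hz] at h1
    exact h1
  · rintro h p hp L hL z hz rfl
    rw [EntropyBound.LightSheet.expansion_eq_divergence hU hK hnull hL hz hp,
      EntropyBound.LightSheet.flux, show EntropyBound.generator L.Φ z = K (L.Φ z) from hL z hz]
    exact h _ hp
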